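/- Let $\theta\in\mathbb R\setminus\mathbb Q$ and let $F(z,w)=(z+\cdots,\;e^{2\pi i\theta}w+\cdots)$ be a quasi-parabolic germ of holomorphic diffeomorphism of $\mathbb C^2$ at $0$ (the dots denote terms of order at least $2$), represented by a holomorphic map on an open neighbourhood $D$ of $0$. Such an $F$ is formally conjugate (by an invertible formal power series map of $\mathbb C^2$ fixing $0$) to a normal form $$\hat F(z,w)=\Bigl(z+\sum_{j\ge 2}a_jz^j,\; e^{2\pi i\theta}w+\sum_{j\ge 1}b_jz^jw\Bigr).$$ Let $\nu=\nu(F)$ be the least $j\ge 2$ with $a_j\ne 0$ and $\mu$ the least $j\ge 1$ with $b_j\neq 0$ (each being $\infty$ if there is no such $j$). The number $\nu(F)$ and, when $\nu<\infty$, the condition $\nu-\mu-1\le 0$ do not depend on the normal form chosen; $F$ is called dynamically separating if $\nu<\infty$ and $\nu-\mu-1\le 0$. A basin of attraction of $F$ at $0$ is a nonempty open set $U\subset D$ with $0\in\overline U$ for which there is a neighbourhood basis $\{\Omega_j\}$ of $0$ such that, for all $j$, $F(U\cap\Omega_j)\subset U\cap\Omega_j$ and $F^{\circ m}(p)\to 0$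 as $m\to\infty$ for all $p\in U\cap\Omega_j$. Suppose that $F$ is dynamically separating and formally conjugate to $\hat F$ as above, and that $$\operatorname{Re}\left(\frac{b_{\nu-1}}{e^{2\pi i\theta}a_\nu}\right)>0 .$$ Then there exist $\nu(F)-1$ pairwise disjoint connected basins of attraction of $F$ at $0$. -/

import Mathlib

open Filter Topology

noncomputable section

/-- A formal self-map of `ℂ²`: a pair of formal power series in two variables. -/
abbrev FormalMap : Type := Fin 2 → MvPowerSeries (Fin 2) ℂ

/-- Composition `A ∘ B` of formal maps. It is meaningful when `B` has no constant term. -/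
def FormalMap.comp (A B : FormalMap) : FormalMap :=
  fun i => MvPowerSeries.subst B (A i)

/-- A formal diffeomorphism of `ℂ²` fixing the origin: no constant term, invertible linear part. -/
def FormalMap.IsDiffeo (Φ : FormalMap) : Prop :=
  (∀ i, MvPowerSeries.constantCoeff (Φ i) = 0) ∧
    (Matrix.of fun i j : Fin 2 => MvPowerSeries.coeff (Finsupp.single j 1) (Φ i)).det ≠ 0

/-- `P` is the Taylor expansion at the origin of the map `F`: near `0`, each component of `F` is the
sum of the corresponding power series. -/
def IsTaylorExpansion (F : (Fin 2 → ℂ) → (Fin 2 → ℂ)) (P : FormalMap) : Prop :=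
  ∀ᶠ z in 𝓝 (0 : Fin 2 → ℂ), ∀ i,
    HasSum (fun n : Fin 2 →₀ ℕ => MvPowerSeries.coeff n (P i) * ∏ j, z j ^ n j) (F z i)

/-- The germ of `F` at `0` is formally conjugate to the formal map `G`: its Taylor expansion `P`
satisfies `Φ ∘ P = G ∘ Φ` for some formal diffeomorphism `Φ`. -/
def IsFormallyConjugate (F : (Fin 2 → ℂ) → (Fin 2 → ℂ)) (G : FormalMap) : Prop :=
  ∃ P Φ : FormalMap, IsTaylorExpansion F P ∧ Φ.IsDiffeo ∧ Φ.comp P = G.comp Φ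

/-- The number `e^{2πiθ}`. -/
def unitEigenvalue (θ : ℝ) : ℂ := Complex.exp (2 * Real.pi * Complex.I * θ)

/-- `F`, holomorphic on the open set `D ∋ 0`, represents a quasi-parabolic germ
`F(z, w) = (z + ⋯, e^{2πiθ} w + ⋯)`, the dots being terms of order at least two. -/
structure IsQuasiParabolic (θ : ℝ) (D : Set (Fin 2 → ℂ)) (F : (Fin 2 → ℂ) → (Fin 2 → ℂ)) :
    Prop where
  isOpen : IsOpen D
  zero_mem : (0 : Fin 2 → ℂ) ∈ D
  differentiableOn : DifferentiableOn ℂ F D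
  map_zero : F 0 = 0
  fderiv_zero : ∀ v : Fin 2 → ℂ, fderiv ℂ F 0 v = ![v 0, unitEigenvalue θ * v 1]

/-- The formal normal form
`(z, w) ↦ (z + ∑_{j ≥ 2} a_j z^j, e^{2πiθ} w + ∑_{j ≥ 1} b_j z^j w)`, given by its coefficients.
The values `a 0`, `a 1` and `b 0` are not used. -/
def quasiParabolicNormalForm (θ : ℝ) (a b : ℕ → ℂ) : FormalMap :=
  ![fun n => if n 1 = 0 then (if n 0 = 0 then 0 else if n 0 = 1 then 1 else a (n 0)) else 0,
    fun n => if n 1 = 1 then (if n 0 = 0 then unitEigenvalue θ else b (n 0)) else 0]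

/-- The least `j ≥ 2` with `a j ≠ 0`, or `∞` if there is none. -/
def normalFormNu (a : ℕ → ℂ) : ℕ∞ := ⨅ (j : ℕ) (_ : 2 ≤ j ∧ a j ≠ 0), (j : ℕ∞)

/-- The least `j ≥ 1` with `b j ≠ 0`, or `∞` if there is none. -/
def normalFormMu (b : ℕ → ℂ) : ℕ∞ := ⨅ (j : ℕ) (_ : 1 ≤ j ∧ b j ≠ 0), (j : ℕ∞)

/-- `F` is dynamically separating: `ν < ∞` and `ν - μ - 1 ≤ 0`, where `ν` and `μ` are read off a
formal normal form of `F` (the condition does not depend on which one). -/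
def IsDynamicallySeparating (θ : ℝ) (F : (Fin 2 → ℂ) → (Fin 2 → ℂ)) : Prop :=
  (∃ a b : ℕ → ℂ, IsFormallyConjugate F (quasiParabolicNormalForm θ a b)) ∧
    ∀ a b : ℕ → ℂ, IsFormallyConjugate F (quasiParabolicNormalForm θ a b) →
      normalFormNu a < ⊤ ∧ normalFormNu a ≤ normalFormMu b + 1

/-- `U` is a basin of attraction at `0` of the map `F` defined on `D`: a nonempty open subset of
`D`, with `0` in its closure, for which there is a neighbourhood basis `B` of `0` such that, for
every `Ω ∈ B`, `F` maps `U ∩ Ω` into itself and the orbits starting in `U ∩ Ω` converge to `0`. -/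
structure IsBasinOfAttraction (D : Set (Fin 2 → ℂ)) (F : (Fin 2 → ℂ) → (Fin 2 → ℂ))
    (U : Set (Fin 2 → ℂ)) : Prop where
  nonempty : U.Nonempty
  isOpen : IsOpen U
  subset : U ⊆ D
  zero_mem_closure : (0 : Fin 2 → ℂ) ∈ closure U
  exists_basis : ∃ B : Set (Set (Fin 2 → ℂ)),
    (𝓝 (0 : Fin 2 → ℂ)).HasBasis (fun Ω => Ω ∈ B) id ∧
      ∀ Ω ∈ B, Set.MapsTo F (U ∩ Ω) (U ∩ Ω) ∧
        ∀ z ∈ U ∩ Ω, Tendsto (fun m : ℕ => F^[m] z) atTop (𝓝 0)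

end

/-! Write ν = m + 1 and λ = e^{2πiθ}. Truncating the formal conjugacy at a high order N gives
genuine local coordinates y = (z, w) in which F is the normal form up to O(‖y‖^N)
(`IsFormallyConjugate.exists_coordinates`). Dynamical separation says b_j = 0 for 1 ≤ j < m, so z' =
z + a z^{m+1} + ⋯ and w' = (λ + b z^m + ⋯) w, with a = a_ν and b = b_{ν-1}.

In the Fatou coordinate Z = -1/(m a z^m) the first component is nearly Z ↦ Z + 1, which preserves a
cone around the positive axis far from 0. The multiplier of w is λ(1 - κ/Z) with κ = b/(mλa). Since
Re κ > 0, on a thin cone its modulus is at most 1 - c|z|^m (`eventually_norm_multiplier_le`).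

The error O(‖y‖^N) is not divisible by z or w, so it is controlled only where w is not too large
compared with z. On the region |w|^M < |z| one has ‖y‖^M ≤ |z|, and N = M(m+3) makes the error
O(|z|^{m+3}). One step multiplies |z| by at least 1 - 2|a||z|^m, while |w|^M shrinks by about (1 -
c|z|^m)^M. For M large the second factor is the smaller, so the region is invariant
(`exists_petal_step`).

The m roots of ω^m = -1/(ma) give m disjoint sectors over the cone. The region |w|^M < |z| over each
is a connected petal, and Re Z grows by at least 1/2 at every step, so orbits tend to 0
(`petal_step`, `isBasinOfAttraction_petal`). -/

noncomputable section

open Asymptotics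

/-! ### Jets at the origin and formal composition -/

/-- `f` agrees near the origin with the power series `A` up to terms of order at least `N`. -/
def HasJet (N : ℕ) (f : (Fin 2 → ℂ) → ℂ) (A : MvPowerSeries (Fin 2) ℂ) : Prop :=
  ∃ p : MvPolynomial (Fin 2) ℂ,
    (∀ n : Fin 2 →₀ ℕ, n.degree < N → p.coeff n = MvPowerSeries.coeff n A) ∧
    (fun x => f x - MvPolynomial.eval x p) =O[𝓝 0] fun x => ‖x‖ ^ N

lemma norm_monomial_le (n : Fin 2 →₀ ℕ) (x : Fin 2 → ℂ) :
    ‖∏ j, x j ^ n j‖ ≤ ‖x‖ ^ n.degree := by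
  rw [norm_prod, Finsupp.degree_eq_sum, ← Finset.prod_pow_eq_pow_sum]
  refine Finset.prod_le_prod (fun _ _ => norm_nonneg _) fun j _ => ?_
  rw [norm_pow]
  exact pow_le_pow_left₀ (norm_nonneg _) (norm_le_pi_norm x j) _

lemma isBigO_norm_pow_of_le {k N : ℕ} (h : N ≤ k) :
    (fun x : Fin 2 → ℂ => ‖x‖ ^ k) =O[𝓝 0] fun x => ‖x‖ ^ N := by
  refine IsBigO.of_bound 1 ?_
  filter_upwards [Metric.ball_mem_nhds (0 : Fin 2 → ℂ) one_pos] with x hx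
  rw [mem_ball_zero_iff] at hx
  simpa using pow_le_pow_of_le_one (norm_nonneg x) hx.le h

lemma MvPolynomial.eval_isBigO {N : ℕ} {p : MvPolynomial (Fin 2) ℂ}
    (hp : ∀ n : Fin 2 →₀ ℕ, n.degree < N → p.coeff n = 0) :
    (fun x => MvPolynomial.eval x p) =O[𝓝 0] fun x : Fin 2 → ℂ => ‖x‖ ^ N := by
  simp only [MvPolynomial.eval_eq']
  refine IsBigO.fun_sum fun n hn => ?_
  have hN : N ≤ n.degree := by
    by_contra h
    exact (MvPolynomial.mem_support_iff.mp hn) (hp n (not_le.mp h))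
  refine IsBigO.trans (IsBigO.of_bound ‖p.coeff n‖ (Eventually.of_forall fun x => ?_))
    (isBigO_norm_pow_of_le hN)
  rw [norm_mul, norm_pow, norm_norm]
  exact mul_le_mul_of_nonneg_left (norm_monomial_le n x) (norm_nonneg _)

lemma MvPolynomial.eval_isBigO_one (p : MvPolynomial (Fin 2) ℂ) :
    (fun x => MvPolynomial.eval x p) =O[𝓝 0] fun _ : Fin 2 → ℂ => (1 : ℝ) := by
  simpa using MvPolynomial.eval_isBigO (N := 0) (p := p) (by simp)

namespace HasJet

variable {N : ℕ} {f g : (Fin 2 → ℂ) → ℂ} {A B : MvPowerSeries (Fin 2) ℂ}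

lemma congr_coeff (h : HasJet N f A)
    (hAB : ∀ n : Fin 2 →₀ ℕ, n.degree < N → MvPowerSeries.coeff n A = MvPowerSeries.coeff n B) :
    HasJet N f B := by
  obtain ⟨p, hp, hf⟩ := h
  exact ⟨p, fun n hn => (hp n hn).trans (hAB n hn), hf⟩

lemma sub_isBigO (hf : HasJet N f A) (hg : HasJet N g A) :
    (fun x => f x - g x) =O[𝓝 0] fun x => ‖x‖ ^ N := by
  obtain ⟨p, hp, hf⟩ := hf
  obtain ⟨q, hq, hg⟩ := hg
  have hpq : (fun x => MvPolynomial.eval x (p - q)) =O[𝓝 0] fun x : Fin 2 → ℂ => ‖x‖ ^ N :=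
    MvPolynomial.eval_isBigO fun n hn => by
      rw [MvPolynomial.coeff_sub, hp n hn, hq n hn, sub_self]
  refine ((hf.sub hg).add hpq).congr_left fun x => ?_
  rw [map_sub]; ring

lemma isBigO_one (hf : HasJet N f A) : f =O[𝓝 0] fun _ => (1 : ℝ) := by
  obtain ⟨p, -, hf⟩ := hf
  have h0 : (fun x : Fin 2 → ℂ => ‖x‖ ^ N) =O[𝓝 0] fun _ => (1 : ℝ) := by
    simpa using isBigO_norm_pow_of_le (Nat.zero_le N)
  exact ((hf.trans h0).add (MvPolynomial.eval_isBigO_one p)).congr_left fun x => by ring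

lemma add (hf : HasJet N f A) (hg : HasJet N g B) :
    HasJet N (fun x => f x + g x) (A + B) := by
  obtain ⟨p, hp, hf⟩ := hf
  obtain ⟨q, hq, hg⟩ := hg
  refine ⟨p + q, fun n hn => ?_, (hf.add hg).congr_left fun x => ?_⟩
  · rw [MvPolynomial.coeff_add, hp n hn, hq n hn, map_add]
  · rw [map_add]; ring

lemma mul (hf : HasJet N f A) (hg : HasJet N g B) :
    HasJet N (fun x => f x * g x) (A * B) := by
  have hg1 := hg.isBigO_one
  obtain ⟨p, hp, hf⟩ := hf
  obtain ⟨q, hq, hg⟩ := hg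
  refine ⟨p * q, fun n hn => ?_, ?_⟩
  · rw [MvPolynomial.coeff_mul, MvPowerSeries.coeff_mul]
    refine Finset.sum_congr rfl fun ij hij => ?_
    have hdeg : ij.1.degree + ij.2.degree = n.degree := by
      rw [← Finset.HasAntidiagonal.mem_antidiagonal.mp hij, map_add]
    rw [hp _ (by omega), hq _ (by omega)]
  -- fg - pq = (f - p)g + p(g - q), with g and p bounded near 0.
  · have h1 := hf.mul hg1
    have h2 := (MvPolynomial.eval_isBigO_one p).mul hg
    simp only [mul_one, one_mul] at h1 h2
    refine (h1.add h2).congr_left fun x => ?_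
    rw [map_mul]; ring

lemma const (N : ℕ) (c : ℂ) : HasJet N (fun _ => c) (MvPowerSeries.C c) := by
  refine ⟨MvPolynomial.C c, fun n _ => ?_, ?_⟩
  · rw [MvPolynomial.coeff_C, MvPowerSeries.coeff_C]
    simp only [eq_comm]
  · simpa using isBigO_zero _ _

/-- A polynomial has its own coefficients as jet. -/
lemma of_coeff {p : MvPolynomial (Fin 2) ℂ}
    (hp : ∀ n : Fin 2 →₀ ℕ, n.degree < N → p.coeff n = MvPowerSeries.coeff n A) :
    HasJet N (fun x => MvPolynomial.eval x p) A :=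
  ⟨p, hp, by simpa using isBigO_zero _ _⟩

lemma eval_aeval {f : (Fin 2 → ℂ) → Fin 2 → ℂ} {A : Fin 2 → MvPowerSeries (Fin 2) ℂ}
    (hf : ∀ i, HasJet N (fun x => f x i) (A i)) (p : MvPolynomial (Fin 2) ℂ) :
    HasJet N (fun x => MvPolynomial.eval (f x) p) (MvPolynomial.aeval A p) := by
  induction p using MvPolynomial.induction_on with
  | C c => simpa [MvPowerSeries.algebraMap_apply] using const N c
  | add p q hp hq => simpa using hp.add hq
  | mul_X p i hp => simpa using hp.mul (hf i)

/-- Substituting maps with given jets into a polynomial with given jet yields the jet of the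
formal substitution. -/
lemma eval_subst {f : (Fin 2 → ℂ) → Fin 2 → ℂ} {A : Fin 2 → MvPowerSeries (Fin 2) ℂ}
    (hf : ∀ i, HasJet N (fun x => f x i) (A i))
    (hA : ∀ i, MvPowerSeries.constantCoeff (A i) = 0)
    {p : MvPolynomial (Fin 2) ℂ} {B : MvPowerSeries (Fin 2) ℂ}
    (hp : ∀ n : Fin 2 →₀ ℕ, n.degree < N → p.coeff n = MvPowerSeries.coeff n B) :
    HasJet N (fun x => MvPolynomial.eval (f x) p) (MvPowerSeries.subst A B) := by
  have hs := MvPowerSeries.hasSubst_of_constantCoeff_zero hA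
  refine (eval_aeval hf p).congr_coeff fun n hn => ?_
  -- The difference p - B has order at least N, and substituting series of order at least 1 does not
  -- lower the order.
  rw [← MvPowerSeries.subst_coe, ← sub_eq_zero, ← map_sub, ← MvPowerSeries.subst_sub hs]
  refine MvPowerSeries.coeff_of_lt_order (lt_of_lt_of_le (Nat.cast_lt.mpr hn) ?_)
  refine le_trans ?_ (MvPowerSeries.le_order_subst hs _)
  have h1 : (1 : ℕ∞) ≤ ⨅ i, (A i).order :=
    le_iInf fun i => MvPowerSeries.one_le_order_iff_constCoeff_eq_zero.mpr (hA i)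
  have h2 : (N : ℕ∞) ≤ ((p : MvPowerSeries (Fin 2) ℂ) - B).order :=
    MvPowerSeries.nat_le_order fun d hd => by
      rw [map_sub, MvPolynomial.coeff_coe, hp d hd, sub_self]
  calc (N : ℕ∞) = 1 * N := (one_mul _).symm
    _ ≤ _ := mul_le_mul' h1 h2

end HasJet

/-! ### Taylor expansions and truncations -/

/-- The truncation of a power series to exponents at most `N` in each variable. -/
def boxTrunc (N : ℕ) (A : MvPowerSeries (Fin 2) ℂ) : MvPolynomial (Fin 2) ℂ :=
  MvPowerSeries.trunc' ℂ (Finsupp.equivFunOnFinite.symm fun _ => N) A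

lemma degree_eq_fin_two (n : Fin 2 →₀ ℕ) : n.degree = n 0 + n 1 := by
  rw [Finsupp.degree_eq_sum, Fin.sum_univ_two]

lemma coeff_boxTrunc {N : ℕ} (A : MvPowerSeries (Fin 2) ℂ) {n : Fin 2 →₀ ℕ} (hn : n.degree < N) :
    (boxTrunc N A).coeff n = MvPowerSeries.coeff n A := by
  rw [boxTrunc, MvPowerSeries.coeff_trunc', if_pos]
  intro i
  rw [degree_eq_fin_two] at hn
  have : n i ≤ n 0 + n 1 := by fin_cases i <;> simp
  simp only [Finsupp.equivFunOnFinite_symm_apply_apply]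
  omega

/-- Convergence at the point (r, r) makes ∑ |coeff n| r^{deg n} finite. Exponents outside the box
have degree at least N, so for ‖x‖ < r the tail is at most this sum times (‖x‖/r)^N. -/
lemma IsTaylorExpansion.hasJet {F : (Fin 2 → ℂ) → Fin 2 → ℂ} {P : FormalMap}
    (h : IsTaylorExpansion F P) (N : ℕ) (i : Fin 2) : HasJet N (fun x => F x i) (P i) := by
  refine ⟨boxTrunc N (P i), fun n hn => coeff_boxTrunc _ hn, ?_⟩
  obtain ⟨ρ, hρ, hball⟩ := Metric.eventually_nhds_iff_ball.mp h
  have hr : (0 : ℝ) < ρ / 2 := by positivity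
  set r : ℝ := ρ / 2
  have hmem : (fun _ => (r : ℂ) : Fin 2 → ℂ) ∈ Metric.ball 0 ρ := by
    rw [mem_ball_zero_iff, pi_norm_lt_iff hρ]
    intro _
    rw [Complex.norm_real, Real.norm_of_nonneg hr.le]
    simp only [r]; linarith
  have hsum : Summable fun n : Fin 2 →₀ ℕ => ‖MvPowerSeries.coeff n (P i)‖ * r ^ n.degree := by
    refine (hball _ hmem i).summable.norm.congr fun n => ?_
    rw [norm_mul, Finset.prod_pow_eq_pow_sum, ← Finsupp.degree_eq_sum, norm_pow,
      Complex.norm_real, Real.norm_of_nonneg hr.le]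
  refine IsBigO.of_bound
    ((∑' n : Fin 2 →₀ ℕ, ‖MvPowerSeries.coeff n (P i)‖ * r ^ n.degree) / r ^ N) ?_
  filter_upwards [Metric.ball_mem_nhds (0 : Fin 2 → ℂ) hr] with x hx
  rw [mem_ball_zero_iff] at hx
  have hxs := hball x (by rw [mem_ball_zero_iff]; simp only [r] at hx; linarith) i
  have heval : MvPolynomial.eval x (boxTrunc N (P i)) =
      ∑ n ∈ Finset.Iic (Finsupp.equivFunOnFinite.symm fun _ : Fin 2 => N),
        MvPowerSeries.coeff n (P i) * ∏ j, x j ^ n j := by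
    rw [MvPolynomial.eval_eq']
    refine (Finset.sum_subset (fun n hn => ?_) fun n _ hn => ?_).trans
      (Finset.sum_congr rfl fun n hn => ?_)
    · rw [Finset.mem_Iic]
      by_contra hle
      rw [MvPolynomial.mem_support_iff, boxTrunc, MvPowerSeries.coeff_trunc', if_neg hle] at hn
      exact hn rfl
    · rw [MvPolynomial.notMem_support_iff.mp hn, zero_mul]
    · rw [boxTrunc, MvPowerSeries.coeff_trunc', if_pos (Finset.mem_Iic.mp hn)]
  set s := Finset.Iic (Finsupp.equivFunOnFinite.symm fun _ : Fin 2 => N)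
  have htail := (s.hasSum_compl_iff (f := fun n => MvPowerSeries.coeff n (P i) * ∏ j, x j ^ n j)
    (a := F x i - ∑ n ∈ s, MvPowerSeries.coeff n (P i) * ∏ j, x j ^ n j)).mpr (by simpa using hxs)
  rw [heval, norm_pow, norm_norm, ← htail.tsum_eq]
  have hterm : ∀ n : {n // n ∉ s}, ‖MvPowerSeries.coeff n.1 (P i) * ∏ j, x j ^ n.1 j‖ ≤
      ‖MvPowerSeries.coeff n.1 (P i)‖ * r ^ n.1.degree * (‖x‖ ^ N / r ^ N) := by
    rintro ⟨n, hn⟩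
    have hN : N ≤ n.degree := by
      by_contra hlt
      apply hn
      rw [degree_eq_fin_two] at hlt
      rw [Finset.mem_Iic]
      intro j
      have : n j ≤ n 0 + n 1 := by fin_cases j <;> simp
      simp only [Finsupp.equivFunOnFinite_symm_apply_apply]
      omega
    obtain ⟨k, hk⟩ := Nat.exists_eq_add_of_le hN
    rw [norm_mul, mul_assoc]
    refine mul_le_mul_of_nonneg_left ((norm_monomial_le n x).trans ?_) (norm_nonneg _)
    rw [hk, pow_add, pow_add, mul_comm (‖x‖ ^ N)]
    have : r ^ N * r ^ k * (‖x‖ ^ N / r ^ N) = r ^ k * ‖x‖ ^ N := by field_simp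
    rw [this]
    exact mul_le_mul_of_nonneg_right (pow_le_pow_left₀ (norm_nonneg _) hx.le _) (by positivity)
  have hsum' := (hsum.subtype (fun n => n ∉ s)).mul_right (‖x‖ ^ N / r ^ N)
  refine (tsum_of_norm_bounded hsum'.hasSum hterm).trans ?_
  rw [tsum_mul_right, div_mul_eq_mul_div, mul_div_assoc]
  exact mul_le_mul_of_nonneg_right
    (hsum.tsum_subtype_le _ {n | n ∉ s} (fun n =>
      mul_nonneg (norm_nonneg _) (pow_nonneg hr.le n.degree))) (by positivity)

lemma IsTaylorExpansion.constantCoeff {F : (Fin 2 → ℂ) → Fin 2 → ℂ} {P : FormalMap}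
    (h : IsTaylorExpansion F P) (h0 : F 0 = 0) (i : Fin 2) :
    MvPowerSeries.constantCoeff (P i) = 0 := by
  have h1 := h.self_of_nhds i
  have h2 : HasSum (fun n : Fin 2 →₀ ℕ =>
      MvPowerSeries.coeff n (P i) * ∏ j, (0 : Fin 2 → ℂ) j ^ n j)
      (MvPowerSeries.constantCoeff (P i)) := by
    convert hasSum_single (0 : Fin 2 →₀ ℕ) fun n hn => ?_ using 1
    · simp
    · obtain ⟨j, hj⟩ := Finsupp.ne_iff.mp hn
      rw [Finset.prod_eq_zero (Finset.mem_univ j), mul_zero]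
      simpa using hj
  rw [h2.unique h1, h0]; rfl

/-! ### Truncated formal diffeomorphisms as local coordinates -/

/-- The polynomial map obtained by truncating a formal map. -/
def FormalMap.truncMap (N : ℕ) (Φ : FormalMap) (x : Fin 2 → ℂ) : Fin 2 → ℂ :=
  fun i => MvPolynomial.eval x (boxTrunc N (Φ i))

lemma contDiff_mvPolynomial_eval (p : MvPolynomial (Fin 2) ℂ) :
    ContDiff ℂ 1 fun x : Fin 2 → ℂ => MvPolynomial.eval x p := by
  induction p using MvPolynomial.induction_on with
  | C c => simpa using contDiff_const
  | add p q hp hq => simpa using hp.add hq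
  | mul_X p i hp => simpa using hp.mul (contDiff_apply ℂ ℂ i)

lemma FormalMap.truncMap_zero {N : ℕ} (hN : 2 ≤ N) {Φ : FormalMap}
    (h0 : ∀ i, MvPowerSeries.constantCoeff (Φ i) = 0) : Φ.truncMap N 0 = 0 := by
  funext i
  have hc : MvPolynomial.constantCoeff (boxTrunc N (Φ i)) = 0 := by
    rw [MvPolynomial.constantCoeff_eq, coeff_boxTrunc _ (by simp; omega)]
    exact h0 i
  simpa [FormalMap.truncMap, MvPolynomial.eval_zero'] using hc

/-- The linear part of a formal map. -/
def FormalMap.linearPart (Φ : FormalMap) : Matrix (Fin 2) (Fin 2) ℂ :=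
  Matrix.of fun i j => MvPowerSeries.coeff (Finsupp.single j 1) (Φ i)

lemma fin_two_degree_lt_two {n : Fin 2 →₀ ℕ} (hn : n.degree < 2) :
    n = 0 ∨ n = Finsupp.single 0 1 ∨ n = Finsupp.single 1 1 := by
  rw [degree_eq_fin_two] at hn
  have h : (n 0 = 0 ∧ n 1 = 0) ∨ (n 0 = 1 ∧ n 1 = 0) ∨ (n 0 = 0 ∧ n 1 = 1) := by omega
  rcases h with ⟨h0, h1⟩ | ⟨h0, h1⟩ | ⟨h0, h1⟩
  · left; ext i; fin_cases i <;> simp [h0, h1]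
  · right; left; ext i; fin_cases i <;> simp [h0, h1]
  · right; right; ext i; fin_cases i <;> simp [h0, h1]

lemma FormalMap.hasFDerivAt_truncMap {N : ℕ} (hN : 2 ≤ N) {Φ : FormalMap}
    (h0 : ∀ i, MvPowerSeries.constantCoeff (Φ i) = 0) :
    HasFDerivAt (Φ.truncMap N)
      (LinearMap.toContinuousLinearMap (Matrix.toLin' Φ.linearPart)) 0 := by
  rw [hasFDerivAt_pi']
  intro i
  have hp : (fun x : Fin 2 → ℂ => MvPolynomial.eval x
      (boxTrunc N (Φ i) - ∑ j, MvPolynomial.C (Φ.linearPart i j) * MvPolynomial.X j)) =O[𝓝 0]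
      fun x => ‖x‖ ^ 2 := by
    refine MvPolynomial.eval_isBigO fun n hn => ?_
    rw [MvPolynomial.coeff_sub, coeff_boxTrunc _ (by omega), Fin.sum_univ_two,
      MvPolynomial.coeff_add, MvPolynomial.coeff_C_mul, MvPolynomial.coeff_C_mul,
      MvPolynomial.coeff_X, MvPolynomial.coeff_X]
    rcases fin_two_degree_lt_two hn with rfl | rfl | rfl
    · simpa using h0 i
    · simp [FormalMap.linearPart, Finsupp.single_left_inj]
    · simp [FormalMap.linearPart, Finsupp.single_left_inj]
  refine HasFDerivAt.of_isLittleO ?_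
  have hlit : (fun x : Fin 2 → ℂ => ‖x‖ ^ 2) =o[𝓝 0] fun x => x - 0 := by
    simpa using isLittleO_norm_pow_id (E' := Fin 2 → ℂ) one_lt_two
  refine (hp.trans_isLittleO hlit).congr_left fun x => ?_
  rw [FormalMap.truncMap_zero hN h0]
  simp only [FormalMap.truncMap, map_sub, map_sum, map_mul, MvPolynomial.eval_C,
    MvPolynomial.eval_X, Pi.zero_apply, sub_zero]
  rfl

/-- A truncated formal diffeomorphism is a local homeomorphism at the origin, and it distorts
distances to the origin by a bounded factor. -/
lemma FormalMap.IsDiffeo.exists_openPartialHomeomorph {N : ℕ} (hN : 2 ≤ N) {Φ : FormalMap}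
    (hΦ : Φ.IsDiffeo) :
    ∃ φ : OpenPartialHomeomorph (Fin 2 → ℂ) (Fin 2 → ℂ),
      (φ : (Fin 2 → ℂ) → Fin 2 → ℂ) = Φ.truncMap N ∧
      0 ∈ φ.source ∧ (fun x => x) =O[𝓝 0] φ := by
  have hder := FormalMap.hasFDerivAt_truncMap hN hΦ.1
  have hdet : IsUnit Φ.linearPart.det := isUnit_iff_ne_zero.mpr hΦ.2
  let e : (Fin 2 → ℂ) ≃L[ℂ] (Fin 2 → ℂ) :=
    (LinearEquiv.ofIsUnitDet (f := Matrix.toLin' Φ.linearPart) (v := Pi.basisFun ℂ (Fin 2))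
      (v' := Pi.basisFun ℂ (Fin 2)) (by
        rwa [LinearMap.toMatrix_eq_toMatrix', LinearMap.toMatrix'_toLin'])).toContinuousLinearEquiv
  have he : (e : (Fin 2 → ℂ) →L[ℂ] (Fin 2 → ℂ)) =
      LinearMap.toContinuousLinearMap (Matrix.toLin' Φ.linearPart) := by
    ext x; rfl
  rw [← he] at hder
  have hcd : ContDiff ℂ 1 (Φ.truncMap N) :=
    contDiff_pi.mpr fun i => contDiff_mvPolynomial_eval _
  have hstrict : HasStrictFDerivAt (Φ.truncMap N) (e : (Fin 2 → ℂ) →L[ℂ] (Fin 2 → ℂ)) 0 :=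
    hcd.contDiffAt.hasStrictFDerivAt' hder one_ne_zero
  refine ⟨hstrict.toOpenPartialHomeomorph _, rfl, hstrict.mem_toOpenPartialHomeomorph_source, ?_⟩
  -- Near 0 the map is equivalent to its invertible derivative e, so x = O(e x) = O(φ x).
  have h1 := (hder.isEquivalent_sub e.toHomeomorph.isInducing).isBigO_symm
  have h2 := (e.isBigO_sub_rev (𝓝 0) 0).trans h1
  simpa [FormalMap.truncMap_zero hN hΦ.1] using h2

/-! ### The normal form in the truncated coordinates -/

/-- The truncation of the normal form. -/
def normalFormPoly (θ : ℝ) (a b : ℕ → ℂ) (N : ℕ) : Fin 2 → MvPolynomial (Fin 2) ℂ :=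
  ![∑ j ∈ Finset.range N, MvPolynomial.monomial (Finsupp.single 0 j)
      (if j = 0 then 0 else if j = 1 then 1 else a j),
    ∑ j ∈ Finset.range N, MvPolynomial.monomial (Finsupp.single 0 j + Finsupp.single 1 1)
      (if j = 0 then unitEigenvalue θ else b j)]

lemma coeff_normalFormPoly (θ : ℝ) (a b : ℕ → ℂ) (N : ℕ) (i : Fin 2) (n : Fin 2 →₀ ℕ)
    (hn : n.degree < N) : (normalFormPoly θ a b N i).coeff n =
      MvPowerSeries.coeff n (quasiParabolicNormalForm θ a b i) := by
  rw [degree_eq_fin_two] at hn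
  fin_cases i
  · change MvPolynomial.coeff n (∑ j ∈ Finset.range N, _) =
      (if n 1 = 0 then (if n 0 = 0 then (0 : ℂ) else if n 0 = 1 then 1 else a (n 0)) else 0)
    rw [MvPolynomial.coeff_sum]
    simp only [MvPolynomial.coeff_monomial]
    split_ifs with h1 h2 h3
    all_goals try
      rw [Finset.sum_eq_single_of_mem (n 0) (Finset.mem_range.mpr (by omega))]
      · rw [if_pos (by ext i; fin_cases i <;> simp [h1])]
        simp [*]
      · intro j _ hj
        rw [if_neg]
        intro h
        exact hj (by rw [← h]; simp)
    refine Finset.sum_eq_zero fun j _ => if_neg fun h => h1 ?_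
    rw [← h]; simp
  · change MvPolynomial.coeff n (∑ j ∈ Finset.range N, _) =
      (if n 1 = 1 then (if n 0 = 0 then unitEigenvalue θ else b (n 0)) else 0)
    rw [MvPolynomial.coeff_sum]
    simp only [MvPolynomial.coeff_monomial]
    split_ifs with h1 h2
    all_goals try
      rw [Finset.sum_eq_single_of_mem (n 0) (Finset.mem_range.mpr (by omega))]
      · rw [if_pos (by ext i; fin_cases i <;> simp [h1])]
        simp [*]
      · intro j _ hj
        rw [if_neg]
        intro h
        exact hj (by rw [← h]; simp)
    refine Finset.sum_eq_zero fun j _ => if_neg fun h => h1 ?_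
    rw [← h]; simp

lemma eval_normalFormPoly_zero (θ : ℝ) (a b : ℕ → ℂ) (N : ℕ) (y : Fin 2 → ℂ) :
    MvPolynomial.eval y (normalFormPoly θ a b N 0) =
      ∑ j ∈ Finset.range N, (if j = 0 then 0 else if j = 1 then 1 else a j) * y 0 ^ j := by
  simp [normalFormPoly, MvPolynomial.eval_monomial]

lemma eval_normalFormPoly_one (θ : ℝ) (a b : ℕ → ℂ) (N : ℕ) (y : Fin 2 → ℂ) :
    MvPolynomial.eval y (normalFormPoly θ a b N 1) =
      (∑ j ∈ Finset.range N, (if j = 0 then unitEigenvalue θ else b j) * y 0 ^ j) * y 1 := by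
  simp only [normalFormPoly, Matrix.cons_val_one, Matrix.cons_val_fin_one, map_sum,
    MvPolynomial.eval_monomial, Finset.sum_mul]
  refine Finset.sum_congr rfl fun j _ => ?_
  rw [Finsupp.prod_fintype _ _ (by simp)]
  simp [Fin.prod_univ_two, mul_assoc]

lemma norm_sum_tail_le (c : ℕ → ℂ) (k t : ℕ) {z : ℂ} (hz : ‖z‖ ≤ 1) :
    ‖∑ j ∈ Finset.range t, c (k + j) * z ^ (k + j)‖ ≤
      (∑ j ∈ Finset.range t, ‖c (k + j)‖) * ‖z‖ ^ k := by
  rw [Finset.sum_mul]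
  refine norm_sum_le_of_le _ fun j _ => ?_
  rw [norm_mul, norm_pow]
  exact mul_le_mul_of_nonneg_left (pow_le_pow_of_le_one (norm_nonneg _) hz (by omega))
    (norm_nonneg _)

/-- The truncated normal form up to higher order terms. -/
lemma exists_bound_normalFormPoly (θ : ℝ) (a b : ℕ → ℂ) {m N : ℕ} (hm : 1 ≤ m) (hN : m + 2 ≤ N)
    (ha : ∀ j, 2 ≤ j → j < m + 1 → a j = 0) (hb : ∀ j, 1 ≤ j → j < m → b j = 0) :
    ∃ C : ℝ, 0 ≤ C ∧ ∀ y : Fin 2 → ℂ, ‖y 0‖ ≤ 1 →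
      ‖MvPolynomial.eval y (normalFormPoly θ a b N 0) - (y 0 + a (m + 1) * y 0 ^ (m + 1))‖ ≤
        C * ‖y 0‖ ^ (m + 2) ∧
      ‖MvPolynomial.eval y (normalFormPoly θ a b N 1) -
        (unitEigenvalue θ * y 1 + b m * y 0 ^ m * y 1)‖ ≤ C * (‖y 0‖ ^ (m + 1) * ‖y 1‖) := by
  obtain ⟨t, rfl⟩ := Nat.exists_eq_add_of_le hN
  let c : ℕ → ℂ := fun j => if j = 0 then 0 else if j = 1 then 1 else a j
  let d : ℕ → ℂ := fun j => if j = 0 then unitEigenvalue θ else b j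
  let Cc := ∑ j ∈ Finset.range t, ‖c (m + 2 + j)‖
  let Cd := ∑ j ∈ Finset.range (1 + t), ‖d (m + 1 + j)‖
  have hCc : 0 ≤ Cc := Finset.sum_nonneg fun _ _ => norm_nonneg _
  have hCd : 0 ≤ Cd := Finset.sum_nonneg fun _ _ => norm_nonneg _
  refine ⟨Cc + Cd, by positivity, fun y hy => ⟨?_, ?_⟩⟩
  · have hmain : ∑ j ∈ Finset.range (m + 2), c j * y 0 ^ j = y 0 + a (m + 1) * y 0 ^ (m + 1) := by
      rw [Finset.sum_range_succ, Finset.sum_eq_single_of_mem 1 (Finset.mem_range.mpr (by omega))]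
      · simp [c, show m ≠ 0 by omega]
      · intro j hj hj1
        rw [Finset.mem_range] at hj
        rcases Nat.eq_zero_or_pos j with rfl | hj0
        · simp [c]
        · simp [c, hj1, show j ≠ 0 by omega, ha j (by omega) hj]
    rw [eval_normalFormPoly_zero]
    change ‖∑ j ∈ Finset.range (m + 2 + t), c j * y 0 ^ j - _‖ ≤ _
    rw [Finset.sum_range_add, hmain, add_sub_cancel_left]
    refine (norm_sum_tail_le c (m + 2) t hy).trans ?_
    exact mul_le_mul_of_nonneg_right (by simp only [Cc] at *; linarith) (by positivity)
  · have hmain : ∑ j ∈ Finset.range (m + 1), d j * y 0 ^ j = unitEigenvalue θ + b m * y 0 ^ m := by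
      rw [Finset.sum_range_succ, Finset.sum_eq_single_of_mem 0 (Finset.mem_range.mpr (by omega))]
      · simp [d, show m ≠ 0 by omega]
      · intro j hj hj0
        rw [Finset.mem_range] at hj
        simp [d, hj0, hb j (by omega) hj]
    rw [eval_normalFormPoly_one]
    change ‖(∑ j ∈ Finset.range (m + 2 + t), d j * y 0 ^ j) * y 1 - _‖ ≤ _
    rw [show m + 2 + t = m + 1 + (1 + t) by ring, Finset.sum_range_add, hmain, ← add_mul, add_mul,
      add_sub_cancel_left, norm_mul, ← mul_assoc]
    refine mul_le_mul_of_nonneg_right ((norm_sum_tail_le d (m + 1) (1 + t) hy).trans ?_)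
      (norm_nonneg _)
    exact mul_le_mul_of_nonneg_right (by simp only [Cd] at *; linarith) (by positivity)

/-- In suitable local coordinates a map that is formally conjugate to a normal form agrees with the
leading terms of the normal form, up to higher order terms of the normal form and an arbitrarily
small error. -/
lemma IsFormallyConjugate.exists_coordinates {F : (Fin 2 → ℂ) → Fin 2 → ℂ} {θ : ℝ} {a b : ℕ → ℂ}
    (h : IsFormallyConjugate F (quasiParabolicNormalForm θ a b)) (h0 : F 0 = 0)
    {m N : ℕ} (hm : 1 ≤ m) (hN : m + 2 ≤ N)
    (ha : ∀ j, 2 ≤ j → j < m + 1 → a j = 0) (hb : ∀ j, 1 ≤ j → j < m → b j = 0) :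
    ∃ φ : OpenPartialHomeomorph (Fin 2 → ℂ) (Fin 2 → ℂ), 0 ∈ φ.source ∧ φ 0 = 0 ∧
      ∃ C : ℝ, 0 ≤ C ∧ ∀ᶠ x in 𝓝 0,
        ‖φ (F x) 0 - (φ x 0 + a (m + 1) * φ x 0 ^ (m + 1))‖ ≤
          C * (‖φ x 0‖ ^ (m + 2) + ‖φ x‖ ^ N) ∧
        ‖φ (F x) 1 - (unitEigenvalue θ * φ x 1 + b m * φ x 0 ^ m * φ x 1)‖ ≤
          C * (‖φ x 0‖ ^ (m + 1) * ‖φ x 1‖ + ‖φ x‖ ^ N) := by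
  obtain ⟨P, Φ, hP, hΦ, hcomp⟩ := h
  obtain ⟨φ, hφ, hsrc, hO⟩ := hΦ.exists_openPartialHomeomorph (N := N) (by omega)
  have hφ0 : φ 0 = 0 := by rw [hφ]; exact FormalMap.truncMap_zero (by omega) hΦ.1
  obtain ⟨C, hC, hCb⟩ := exists_bound_normalFormPoly θ a b hm hN ha hb
  -- Both maps have the jet of Φ ∘ P = G ∘ Φ, where G is the normal form, so they differ by
  -- O(‖x‖^N); then ‖x‖ = O(‖φ x‖).
  have herr : ∀ i, (fun x => φ (F x) i - MvPolynomial.eval (φ x) (normalFormPoly θ a b N i))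
      =O[𝓝 0] fun x => ‖φ x‖ ^ N := by
    intro i
    have h1 : HasJet N (fun x => φ (F x) i) (MvPowerSeries.subst P (Φ i)) := by
      rw [hφ]
      exact HasJet.eval_subst (hP.hasJet N) (hP.constantCoeff h0) fun n hn => coeff_boxTrunc _ hn
    have h2 : HasJet N (fun x => MvPolynomial.eval (φ x) (normalFormPoly θ a b N i))
        (MvPowerSeries.subst Φ (quasiParabolicNormalForm θ a b i)) := by
      refine HasJet.eval_subst (fun j => ?_) hΦ.1 fun n hn => coeff_normalFormPoly θ a b N i n hn
      rw [hφ]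
      exact HasJet.of_coeff fun n hn => coeff_boxTrunc _ hn
    rw [show MvPowerSeries.subst P (Φ i) = MvPowerSeries.subst Φ (quasiParabolicNormalForm θ a b i)
      from congrFun hcomp i] at h1
    exact (h1.sub_isBigO h2).trans (hO.norm_norm.pow N)
  obtain ⟨C0, hC0, hb0⟩ := (herr 0).exists_nonneg
  obtain ⟨C1, hC1, hb1⟩ := (herr 1).exists_nonneg
  refine ⟨φ, hsrc, hφ0, C + C0 + C1, by positivity, ?_⟩
  have hsmall : ∀ᶠ x in 𝓝 0, ‖φ x 0‖ ≤ 1 := by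
    have hcont : ContinuousAt (fun x => ‖φ x 0‖) 0 :=
      ((continuous_apply 0).continuousAt.comp (φ.continuousAt hsrc)).norm
    refine (hcont.eventually_lt continuousAt_const ?_).mono fun x hx => hx.le
    simp [hφ0]
  filter_upwards [hsmall, hb0.bound, hb1.bound] with x hx hx0 hx1
  obtain ⟨hA, hB⟩ := hCb (φ x) hx
  rw [norm_pow, norm_norm] at hx0 hx1
  have e1 : 0 ≤ ‖φ x 0‖ ^ (m + 2) := by positivity
  have e2 : 0 ≤ ‖φ x‖ ^ N := by positivity
  have e3 : 0 ≤ ‖φ x 0‖ ^ (m + 1) * ‖φ x 1‖ := by positivity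
  constructor
  · refine (norm_sub_le_norm_sub_add_norm_sub _ _ _).trans ((add_le_add hx0 hA).trans ?_)
    nlinarith [mul_nonneg hC e2, mul_nonneg hC0 e1, mul_nonneg hC1 e1, mul_nonneg hC1 e2]
  · refine (norm_sub_le_norm_sub_add_norm_sub _ _ _).trans ((add_le_add hx1 hB).trans ?_)
    nlinarith [mul_nonneg hC e2, mul_nonneg hC0 e3, mul_nonneg hC1 e3, mul_nonneg hC0 e2]

/-! ### Cones, the Fatou coordinate and the multiplier of w -/

/-- The open cone `|Im Z| < k Re Z` around the positive real axis. -/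
def openCone (k : ℝ) : Set ℂ := {Z | |Z.im| < k * Z.re}

/-- The Fatou coordinate `-1 / (m a z^m)` of the parabolic germ `z + a z^(m+1) + ⋯`. -/
def fatouCoord (m : ℕ) (a z : ℂ) : ℂ := -(m * a * z ^ m)⁻¹

lemma norm_fatouCoord (m : ℕ) (a z : ℂ) :
    ‖fatouCoord m a z‖ = (m * ‖a‖ * ‖z‖ ^ m)⁻¹ := by
  simp [fatouCoord]

lemma re_pos_of_mem_openCone {k : ℝ} (hk : 0 < k) {Z : ℂ} (hZ : Z ∈ openCone k) : 0 < Z.re :=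
  pos_of_mul_pos_right ((abs_nonneg _).trans_lt hZ) hk.le

lemma norm_le_two_mul_re_of_mem_openCone {k : ℝ} (hk : 0 < k) (hk1 : k ≤ 1) {Z : ℂ}
    (hZ : Z ∈ openCone k) : ‖Z‖ ≤ 2 * Z.re := by
  have hre := re_pos_of_mem_openCone hk hZ
  have h1 := Complex.norm_le_abs_re_add_abs_im Z
  have h2 : |Z.im| < k * Z.re := hZ
  rw [abs_of_pos hre] at h1
  nlinarith

lemma isOpen_openCone (k : ℝ) : IsOpen (openCone k) :=
  isOpen_lt (by fun_prop) (by fun_prop)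

lemma convex_openCone (k : ℝ) : Convex ℝ (openCone k) := by
  intro x hx y hy s t hs ht hst
  simp only [openCone, Set.mem_ofPred_eq, Complex.add_im, Complex.real_smul, Complex.mul_im,
    Complex.add_re, Complex.mul_re, Complex.ofReal_re, Complex.ofReal_im, zero_mul, sub_zero,
    add_zero] at *
  have h1 : |s * x.im + t * y.im| ≤ s * |x.im| + t * |y.im| := by
    refine (abs_add_le _ _).trans ?_
    rw [abs_mul, abs_mul, abs_of_nonneg hs, abs_of_nonneg ht]
  rcases hs.eq_or_lt with rfl | hs
  · obtain rfl : t = 1 := by linarith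
    simpa using hy
  · nlinarith [mul_lt_mul_of_pos_left hx hs, mul_le_mul_of_nonneg_left hy.le ht]

/-- A translation by a vector close to `1` maps the cone into itself and increases the modulus. -/
lemma openCone_step {k : ℝ} (hk : 0 < k) (hk1 : k ≤ 1) {Z Z' : ℂ} (hZ : Z ∈ openCone k)
    (h : ‖Z' - (Z + 1)‖ ≤ k / 4) :
    Z' ∈ openCone k ∧ ‖Z‖ < ‖Z'‖ ∧ Z.re + 1 / 2 ≤ Z'.re := by
  obtain ⟨η, rfl⟩ : ∃ η, Z' = Z + 1 + η := ⟨Z' - (Z + 1), by ring⟩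
  rw [add_sub_cancel_left] at h
  have hre := re_pos_of_mem_openCone hk hZ
  have h2 : |Z.im| < k * Z.re := hZ
  have hηr := abs_le.mp ((Complex.abs_re_le_norm η).trans h)
  have hηi := (Complex.abs_im_le_norm η).trans h
  refine ⟨?_, ?_, ?_⟩
  · change |(Z + 1 + η).im| < k * (Z + 1 + η).re
    simp only [Complex.add_im, Complex.add_re, Complex.one_im, Complex.one_re, add_zero]
    -- |Im| grows by at most k/4, while k Re grows by at least 3k/4.
    refine (abs_add_le _ _).trans_lt ?_
    nlinarith
  · rw [← sq_lt_sq₀ (norm_nonneg _) (norm_nonneg _), Complex.sq_norm, Complex.sq_norm,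
      Complex.normSq_apply, Complex.normSq_apply]
    simp only [Complex.add_im, Complex.add_re, Complex.one_im, Complex.one_re, add_zero]
    -- In |Z'|² the cross term of the imaginary parts costs at most Re Z / 2; the real part gains at
    -- least 3 Re Z / 2.
    have h3 : |Z.im * η.im| ≤ Z.re * (1 / 4) := by
      rw [abs_mul]
      have : |Z.im| ≤ Z.re := by nlinarith
      exact mul_le_mul this (by linarith) (abs_nonneg _) hre.le
    nlinarith [abs_le.mp h3, sq_nonneg η.im]
  · simp only [Complex.add_re, Complex.one_re]
    linarith

/-- For a complex number `κ` in the right half plane, `Re (κ / Z)` is comparable to `1 / |Z|` on a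
thin enough cone. -/
lemma exists_openCone_re_mul_conj {κ : ℂ} (hκ : 0 < κ.re) :
    ∃ k : ℝ, 0 < k ∧ k ≤ 1 ∧
      ∀ Z ∈ openCone k, κ.re / 4 * ‖Z‖ ≤ κ.re * Z.re + κ.im * Z.im := by
  have hden : 0 < 2 * (|κ.im| + 1) := by positivity
  -- This k gives k|Im κ| ≤ Re κ / 2, so the right side, Re(κ Z̄), is at least Re κ Re Z / 2 ≥ Re κ
  -- |Z| / 4.
  refine ⟨min 1 (κ.re / (2 * (|κ.im| + 1))), lt_min one_pos (div_pos hκ hden), min_le_left _ _, ?_⟩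
  intro Z hZ
  have hk : 0 < min 1 (κ.re / (2 * (|κ.im| + 1))) := lt_min one_pos (div_pos hκ hden)
  have hre := re_pos_of_mem_openCone hk hZ
  have hn := norm_le_two_mul_re_of_mem_openCone hk (min_le_left _ _) hZ
  have hZ' : |Z.im| < min 1 (κ.re / (2 * (|κ.im| + 1))) * Z.re := hZ
  have h1 : min 1 (κ.re / (2 * (|κ.im| + 1))) * (2 * (|κ.im| + 1)) ≤ κ.re := by
    rw [← le_div_iff₀ hden]; exact min_le_right _ _
  set k := min 1 (κ.re / (2 * (|κ.im| + 1)))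
  have h2 : |κ.im * Z.im| ≤ κ.re / 2 * Z.re := by
    rw [abs_mul]
    calc |κ.im| * |Z.im| ≤ |κ.im| * (k * Z.re) := by gcongr
      _ = (|κ.im| * k) * Z.re := by ring
      _ ≤ _ := by gcongr; nlinarith
  nlinarith [abs_le.mp h2]

/-- |Z - κ|² = |Z|² - 2 Re(κ Z̄) + |κ|² ≤ |Z|² - c|Z| ≤ (|Z| - c/2)²; divide by |Z|. -/
lemma norm_one_sub_div_le {κ Z : ℂ} {c : ℝ} (hc : 0 < c) (hZ : Z ≠ 0)
    (h : c * ‖Z‖ ≤ κ.re * Z.re + κ.im * Z.im) (h1 : ‖κ‖ ^ 2 ≤ c * ‖Z‖) (h2 : c ≤ ‖Z‖) :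
    ‖1 - κ / Z‖ ≤ 1 - c / 2 * ‖Z‖⁻¹ := by
  have hZ0 : 0 < ‖Z‖ := norm_pos_iff.mpr hZ
  have hnn : 0 ≤ 1 - c / 2 * ‖Z‖⁻¹ := by
    rw [sub_nonneg, ← div_eq_mul_inv, div_le_one hZ0]; linarith
  have hmul : 1 - κ / Z = (Z - κ) / Z := by field_simp
  have hrhs : 1 - c / 2 * ‖Z‖⁻¹ = (‖Z‖ - c / 2) / ‖Z‖ := by field_simp
  rw [hmul, norm_div, hrhs]
  gcongr
  rw [← sq_le_sq₀ (norm_nonneg _) (by linarith)]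
  have e1 : ‖Z - κ‖ ^ 2 = ‖Z‖ ^ 2 - 2 * (κ.re * Z.re + κ.im * Z.im) + ‖κ‖ ^ 2 := by
    simp only [Complex.sq_norm, Complex.normSq_apply, Complex.sub_re, Complex.sub_im]; ring
  rw [e1]
  nlinarith

lemma eventually_inv_one_add_pow (m : ℕ) {ε : ℝ} (hε : 0 < ε) :
    ∀ᶠ y in 𝓝 (0 : ℂ), ‖((1 + y) ^ m)⁻¹ - 1 + (m : ℂ) * y‖ ≤ ε * ‖y‖ := by
  have hd : HasDerivAt (fun y : ℂ => ((1 + y) ^ m)⁻¹) (-(m : ℂ)) 0 := by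
    have h1 : HasDerivAt (fun y : ℂ => 1 + y) 1 0 := (hasDerivAt_id (0 : ℂ)).const_add 1
    have h2 := (h1.fun_pow m).fun_inv (by simp)
    simpa using h2
  have := hd.isLittleO.bound hε
  filter_upwards [this] with y hy
  simpa [mul_comm, sub_neg_eq_add] using hy

/-- The Fatou coordinate conjugates a parabolic germ to a small perturbation of the translation
by `1`. -/
lemma eventually_fatouCoord_step {m : ℕ} (hm : 1 ≤ m) {a : ℂ} (ha : a ≠ 0) {C ε α : ℝ}
    (hε : 0 < ε) (hα : 0 < α) :
    ∀ᶠ z in 𝓝 (0 : ℂ), z ≠ 0 → ∀ z', ‖z' - (z + a * z ^ (m + 1))‖ ≤ C * ‖z‖ ^ (m + 2) →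
      z' ≠ 0 ∧ ‖fatouCoord m a z' - (fatouCoord m a z + 1)‖ ≤ ε ∧ |(z / z').arg| < α ∧
        ‖z‖ * (1 - 2 * ‖a‖ * ‖z‖ ^ m) ≤ ‖z'‖ := by
  have ha0 : 0 < ‖a‖ := norm_pos_iff.mpr ha
  have harg : ∀ᶠ y in 𝓝 (0 : ℂ), |((1 + y)⁻¹).arg| < α := by
    have hc : ContinuousAt (fun y : ℂ => |((1 + y)⁻¹).arg|) 0 := by
      refine ContinuousAt.abs (ContinuousAt.comp (g := Complex.arg) ?_ ?_)
      · exact Complex.continuousAt_arg (by simp)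
      · exact ContinuousAt.inv₀ (by fun_prop) (by simp)
    exact hc.eventually_lt continuousAt_const (by simpa using hα)
  have hne : ∀ᶠ y in 𝓝 (0 : ℂ), 1 + y ≠ 0 :=
    ContinuousAt.eventually_ne (by fun_prop) (by simp)
  obtain ⟨η, hη, hball⟩ := Metric.eventually_nhds_iff_ball.mp
    ((eventually_inv_one_add_pow m (ε := ε / 4) (by positivity)).and (harg.and hne))
  have hs1 : ∀ᶠ z in 𝓝 (0 : ℂ), C * ‖z‖ < ‖a‖ :=
    ContinuousAt.eventually_lt (by fun_prop) continuousAt_const (by simpa using ha0)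
  have hs2 : ∀ᶠ z in 𝓝 (0 : ℂ), C * ‖z‖ < ‖a‖ * (ε / 2) :=
    ContinuousAt.eventually_lt (by fun_prop) continuousAt_const (by simp; positivity)
  have hs3 : ∀ᶠ z in 𝓝 (0 : ℂ), 2 * ‖a‖ * ‖z‖ ^ m < η :=
    ContinuousAt.eventually_lt (by fun_prop) continuousAt_const
      (by simpa [show m ≠ 0 by omega] using hη)
  filter_upwards [hs1, hs2, hs3] with z h1 h2 h3 hz z' hz'
  have hz0 : 0 < ‖z‖ := norm_pos_iff.mpr hz
  -- In z' = z(1 + y), the relative increment y is a z^m up to C|z|^{m+1}.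
  obtain ⟨y, rfl⟩ : ∃ y, z' = z * (1 + y) := ⟨z' / z - 1, by field_simp; ring⟩
  have hx0 : 0 < ‖z‖ ^ m := by positivity
  have hy : ‖y - a * z ^ m‖ ≤ C * ‖z‖ * ‖z‖ ^ m := by
    have e : z * (1 + y) - (z + a * z ^ (m + 1)) = z * (y - a * z ^ m) := by ring
    rw [e, norm_mul] at hz'
    refine le_of_mul_le_mul_left (hz'.trans (le_of_eq ?_)) hz0
    ring
  have hyn : ‖y‖ ≤ 2 * ‖a‖ * ‖z‖ ^ m := by
    have := norm_add_le (y - a * z ^ m) (a * z ^ m)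
    rw [sub_add_cancel, norm_mul, norm_pow] at this
    nlinarith
  obtain ⟨hb1, hb2, hb3⟩ := hball y (by rw [mem_ball_zero_iff]; linarith)
  refine ⟨mul_ne_zero hz hb3, ?_, ?_, ?_⟩
  · have hm0 : (m : ℂ) ≠ 0 := by exact_mod_cast (by omega : m ≠ 0)
    have hzm : z ^ m ≠ 0 := pow_ne_zero _ hz
    have hym : (1 + y) ^ m ≠ 0 := pow_ne_zero _ hb3
    -- With Z the Fatou coordinate, Z m a z^m = -1. This splits the defect into the second-order
    -- remainder of (1 + y)^{-m} and the error in y; each is small relative to |z|^m.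
    have e : fatouCoord m a (z * (1 + y)) - (fatouCoord m a z + 1) =
        fatouCoord m a z * (((1 + y) ^ m)⁻¹ - 1 + m * y) -
          fatouCoord m a z * (m * (y - a * z ^ m)) := by
      simp only [fatouCoord, mul_pow]
      field_simp
      ring
    rw [e]
    refine (norm_sub_le _ _).trans ?_
    rw [norm_mul, norm_mul, norm_mul, norm_fatouCoord, Complex.norm_natCast, ← mul_add]
    have hm1 : (1 : ℝ) ≤ m := by exact_mod_cast hm
    have hpos : 0 < m * ‖a‖ * ‖z‖ ^ m := by positivity
    rw [inv_mul_le_iff₀ hpos]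
    have t1 : ε / 4 * ‖y‖ ≤ ε / 4 * (2 * ‖a‖ * ‖z‖ ^ m) := by gcongr
    have t2 : m * ‖y - a * z ^ m‖ ≤ m * (‖a‖ * (ε / 2) * ‖z‖ ^ m) := by
      refine mul_le_mul_of_nonneg_left (hy.trans ?_) (by positivity)
      exact mul_le_mul_of_nonneg_right h2.le hx0.le
    have t3 : ε / 4 * (2 * ‖a‖ * ‖z‖ ^ m) ≤ m * (ε / 4 * (2 * ‖a‖ * ‖z‖ ^ m)) :=
      le_mul_of_one_le_left (by positivity) hm1
    calc _ ≤ m * (ε / 4 * (2 * ‖a‖ * ‖z‖ ^ m)) + m * (‖a‖ * (ε / 2) * ‖z‖ ^ m) := by linarith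
      _ = _ := by ring
  · have : z / (z * (1 + y)) = (1 + y)⁻¹ := by field_simp
    rwa [this]
  · rw [norm_mul]
    refine mul_le_mul_of_nonneg_left ?_ hz0.le
    have := norm_sub_norm_le (1 : ℂ) (-y)
    rw [norm_neg, norm_one, sub_neg_eq_add] at this
    linarith

/-- In the Fatou coordinate Z, l + b z^m = l(1 - κ/Z) with κ = b/(m l a). The sign condition `hre`
makes κ/Z point into the right half plane on a thin cone, and 1/|Z| = m|a||z|^m. -/
lemma eventually_norm_multiplier_le {m : ℕ} (hm : 1 ≤ m) {a l b : ℂ} (ha : a ≠ 0) (hl : ‖l‖ = 1)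
    (hre : 0 < (b / (l * a)).re) :
    ∃ k c : ℝ, 0 < k ∧ k ≤ 1 ∧ 0 < c ∧ ∀ᶠ z in 𝓝 (0 : ℂ), z ≠ 0 → fatouCoord m a z ∈ openCone k →
      ‖l + b * z ^ m‖ ≤ 1 - c * ‖z‖ ^ m := by
  have hm0 : (0 : ℝ) < m := by exact_mod_cast hm
  have ha0 : 0 < ‖a‖ := norm_pos_iff.mpr ha
  have hl0 : l ≠ 0 := by rw [← norm_pos_iff, hl]; exact one_pos
  set κ : ℂ := b / (l * a) / (m : ℝ)
  have hκ : 0 < κ.re := by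
    simp only [κ, Complex.div_ofReal_re]; positivity
  obtain ⟨k, hk, hk1, hcone⟩ := exists_openCone_re_mul_conj hκ
  refine ⟨k, κ.re / 4 / 2 * (m * ‖a‖), hk, hk1, by positivity, ?_⟩
  have hs1 : ∀ᶠ z in 𝓝 (0 : ℂ), ‖κ‖ ^ 2 * (m * ‖a‖ * ‖z‖ ^ m) < κ.re / 4 :=
    ContinuousAt.eventually_lt (by fun_prop) continuousAt_const
      (by simpa [show m ≠ 0 by omega] using hκ)
  have hs2 : ∀ᶠ z in 𝓝 (0 : ℂ), κ.re / 4 * (m * ‖a‖ * ‖z‖ ^ m) < 1 :=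
    ContinuousAt.eventually_lt (by fun_prop) continuousAt_const
      (by simp [show m ≠ 0 by omega])
  filter_upwards [hs1, hs2] with z h1 h2 hz hZ
  have hz0 : 0 < ‖z‖ := norm_pos_iff.mpr hz
  have hpos : 0 < m * ‖a‖ * ‖z‖ ^ m := by positivity
  have hZ0 : fatouCoord m a z ≠ 0 := by
    rw [← norm_pos_iff, norm_fatouCoord]; positivity
  have key := norm_one_sub_div_le (κ := κ) (Z := fatouCoord m a z) (c := κ.re / 4) (by positivity)
    hZ0 (hcone _ hZ) (by rw [norm_fatouCoord, ← div_eq_mul_inv, le_div_iff₀ hpos]; exact h1.le)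
    (by rw [norm_fatouCoord, ← one_div, le_div_iff₀ hpos]; exact h2.le)
  have hmC : (m : ℂ) ≠ 0 := by exact_mod_cast hm0.ne'
  have e : l + b * z ^ m = l * (1 - κ / fatouCoord m a z) := by
    simp only [κ, fatouCoord, Complex.ofReal_natCast]
    field_simp
    ring
  rw [e, norm_mul, hl, one_mul]
  refine key.trans (le_of_eq ?_)
  rw [norm_fatouCoord, inv_inv]
  ring

/-- By Bernoulli, (1 - cx)^M ≤ (1 + cx)^{-M} ≤ 1/(1 + Mcx), and Ax ≤ 1/2 with Mc > 2A puts this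
below 1 - Ax. It compares the contraction of |w|^M with that of |z|, and M x need not be small. -/
lemma one_sub_pow_lt {x c A : ℝ} {M : ℕ} (hx : 0 < x) (hc : 0 ≤ c) (hcx : c * x ≤ 1)
    (hAx : 2 * (A * x) ≤ 1) (hM : 2 * A < M * c) : (1 - c * x) ^ M < 1 - A * x := by
  have hcx0 : 0 ≤ c * x := by positivity
  have hb : 1 + M * (c * x) ≤ (1 + c * x) ^ M := one_add_mul_le_pow (by linarith) M
  have hprod : (1 - c * x) ^ M * (1 + c * x) ^ M ≤ 1 := by
    rw [← mul_pow]
    exact pow_le_one₀ (mul_nonneg (by linarith) (by linarith)) (by nlinarith)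
  have h0 : 0 ≤ (1 - c * x) ^ M := pow_nonneg (by linarith) _
  have hMc : 0 ≤ M * (c * x) := by positivity
  have h1 : (1 - c * x) ^ M * (1 + M * (c * x)) ≤ 1 :=
    (mul_le_mul_of_nonneg_left hb h0).trans hprod
  have h2 : 1 < (1 - A * x) * (1 + M * (c * x)) := by
    have : 2 * A * x < M * c * x := mul_lt_mul_of_pos_right hM hx
    nlinarith
  by_contra hcon
  have := mul_le_mul_of_nonneg_right (not_lt.mp hcon) (by linarith : 0 ≤ 1 + M * (c * x))
  linarith

/-- One step of the dynamics in the region `|w|^M < |z|` over a thin sector. -/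
lemma exists_petal_step {m : ℕ} (hm : 1 ≤ m) {a l b : ℂ} (ha : a ≠ 0) (hl : ‖l‖ = 1)
    (hre : 0 < (b / (l * a)).re) {α : ℝ} (hα : 0 < α) :
    ∃ (k : ℝ) (M : ℕ), 0 < k ∧ k ≤ 1 ∧ 1 ≤ M ∧ ∀ C : ℝ, 0 ≤ C → ∀ᶠ z in 𝓝 (0 : ℂ), z ≠ 0 →
      fatouCoord m a z ∈ openCone k → ∀ (w z' w' : ℂ) (s : ℝ), ‖w‖ ^ M < ‖z‖ → 0 ≤ s → s ^ M ≤ ‖z‖ →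
        ‖z' - (z + a * z ^ (m + 1))‖ ≤ C * (‖z‖ ^ (m + 2) + s ^ (M * (m + 3))) →
        ‖w' - (l * w + b * z ^ m * w)‖ ≤ C * (‖z‖ ^ (m + 1) * ‖w‖ + s ^ (M * (m + 3))) →
        z' ≠ 0 ∧ ‖fatouCoord m a z' - (fatouCoord m a z + 1)‖ ≤ k / 4 ∧ |(z / z').arg| < α ∧
          ‖w'‖ ^ M < ‖z'‖ := by
  have ha0 : 0 < ‖a‖ := norm_pos_iff.mpr ha
  obtain ⟨k, c, hk, hk1, hc, hmult⟩ := eventually_norm_multiplier_le hm ha hl hre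
  -- Half of c is kept to absorb errors, and |z| may lose a factor 1 - 2|a||z|^m: `one_sub_pow_lt`
  -- is applied with rate c/2 and A = 2‖a‖.
  obtain ⟨M, hM⟩ := exists_nat_gt (2 * (2 * ‖a‖) / (c / 2))
  rw [div_lt_iff₀ (by positivity)] at hM
  have hM0 : M ≠ 0 := by
    rintro rfl
    rw [Nat.cast_zero, zero_mul] at hM
    linarith
  -- M is fixed before C, because C comes from coordinates truncated at order M(m+3).
  refine ⟨k, M, hk, hk1, by omega, fun C hC => ?_⟩
  have hm0 : m ≠ 0 := by omega
  have hs1 : ∀ᶠ z in 𝓝 (0 : ℂ), ‖z‖ < 1 :=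
    ContinuousAt.eventually_lt (by fun_prop) continuousAt_const (by simp)
  have hs2 : ∀ᶠ z in 𝓝 (0 : ℂ), 2 * C * ‖z‖ < c / 2 :=
    ContinuousAt.eventually_lt (by fun_prop) continuousAt_const (by simpa using hc)
  have hs3 : ∀ᶠ z in 𝓝 (0 : ℂ), c / 2 * ‖z‖ ^ m < 1 :=
    ContinuousAt.eventually_lt (by fun_prop) continuousAt_const (by simp [hm0])
  have hs4 : ∀ᶠ z in 𝓝 (0 : ℂ), 2 * (2 * ‖a‖ * ‖z‖ ^ m) < 1 :=
    ContinuousAt.eventually_lt (by fun_prop) continuousAt_const (by simp [hm0])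
  filter_upwards [hmult, hs1, hs2, hs3, hs4,
    eventually_fatouCoord_step hm ha (C := 2 * C) (by positivity : 0 < k / 4) hα]
    with z h0 h1 h2 h3 h4 hstep hz hZ w z' w' s hw hs hsM hz' hw'
  have hz0 : 0 < ‖z‖ := norm_pos_iff.mpr hz
  have hx0 : 0 < ‖z‖ ^ m := by positivity
  have hsN : s ^ (M * (m + 3)) ≤ ‖z‖ ^ (m + 3) := by
    rw [pow_mul]; exact pow_le_pow_left₀ (by positivity) hsM _
  have hz'' : ‖z' - (z + a * z ^ (m + 1))‖ ≤ 2 * C * ‖z‖ ^ (m + 2) := by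
    have : ‖z‖ ^ (m + 3) ≤ ‖z‖ ^ (m + 2) := pow_le_pow_of_le_one hz0.le h1.le (by omega)
    refine hz'.trans ?_
    rw [mul_comm 2 C, mul_assoc]
    gcongr
    linarith
  obtain ⟨p1, p2, p3, p4⟩ := hstep hz z' hz''
  refine ⟨p1, p2, p3, lt_of_lt_of_le ?_ p4⟩
  -- ρ = |z|^{1/M} bounds |w| and dominates |z|, so every error in w' becomes a small multiple of
  -- |z|^m ρ, even when w = 0.
  obtain ⟨ρ, hρ0, hρ⟩ : ∃ ρ : ℝ, 0 ≤ ρ ∧ ρ ^ M = ‖z‖ :=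
    ⟨‖z‖ ^ ((M : ℝ)⁻¹), by positivity, Real.rpow_inv_natCast_pow hz0.le hM0⟩
  have hwρ : ‖w‖ < ρ := lt_of_pow_lt_pow_left₀ M hρ0 (by rwa [hρ])
  have hρ1 : ρ ≤ 1 := by
    by_contra hcon
    have := one_lt_pow₀ (not_le.mp hcon) hM0
    linarith
  have hzρ : ‖z‖ ≤ ρ := by
    rw [← hρ]; exact pow_le_of_le_one hρ0 hρ1 hM0
  have hmul : ‖l * w + b * z ^ m * w‖ ≤ (1 - c * ‖z‖ ^ m) * ρ := by
    rw [← add_mul, norm_mul]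
    exact mul_le_mul (h0 hz hZ) hwρ.le (norm_nonneg _) ((norm_nonneg _).trans (h0 hz hZ))
  have herr : ‖z‖ ^ (m + 1) * ‖w‖ + s ^ (M * (m + 3)) ≤ 2 * ‖z‖ * ‖z‖ ^ m * ρ := by
    have t1 : ‖z‖ ^ (m + 1) * ‖w‖ ≤ ‖z‖ * ‖z‖ ^ m * ρ := by
      rw [pow_succ, mul_comm (‖z‖ ^ m)]; gcongr
    have t2 : ‖z‖ ^ (m + 3) ≤ ‖z‖ * ‖z‖ ^ m * ρ := by
      have : ‖z‖ ^ (m + 3) = ‖z‖ * ‖z‖ ^ m * (‖z‖ * ‖z‖) := by ring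
      rw [this]
      gcongr
      nlinarith
    linarith
  have hw'n : ‖w'‖ ≤ ρ * (1 - c / 2 * ‖z‖ ^ m) := by
    have t := norm_add_le (w' - (l * w + b * z ^ m * w)) (l * w + b * z ^ m * w)
    rw [sub_add_cancel] at t
    have t2 : C * (2 * ‖z‖ * ‖z‖ ^ m * ρ) ≤ c / 2 * (‖z‖ ^ m * ρ) := by
      have : C * (2 * ‖z‖ * ‖z‖ ^ m * ρ) = (2 * C * ‖z‖) * (‖z‖ ^ m * ρ) := by ring
      rw [this]
      gcongr
    have t3 := hw'.trans (mul_le_mul_of_nonneg_left herr hC)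
    linarith
  calc ‖w'‖ ^ M ≤ (ρ * (1 - c / 2 * ‖z‖ ^ m)) ^ M := pow_le_pow_left₀ (norm_nonneg _) hw'n _
    _ = ‖z‖ * (1 - c / 2 * ‖z‖ ^ m) ^ M := by rw [mul_pow, hρ]
    _ < ‖z‖ * (1 - 2 * ‖a‖ * ‖z‖ ^ m) := by
      refine mul_lt_mul_of_pos_left ?_ hz0
      exact one_sub_pow_lt hx0 (by positivity) h3.le h4.le hM

/-! ### Geometry of the petals -/

lemma arg_cpow_nat_inv {m : ℕ} (hm : 1 ≤ m) {Z : ℂ} (hZ : Z ≠ 0) :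
    (Z ^ ((m : ℂ)⁻¹)).arg = Z.arg / m := by
  have hm1 : (1 : ℝ) ≤ m := by exact_mod_cast hm
  have him : (Complex.log Z * ((m : ℂ)⁻¹)).im = Z.arg / m := by
    rw [← div_eq_mul_inv, ← Complex.ofReal_natCast, Complex.div_ofReal_im, Complex.log_im]
  have habs : |Z.arg / m| ≤ |Z.arg| := by
    rw [abs_div, Nat.abs_cast]
    exact div_le_self (abs_nonneg _) hm1
  rw [Complex.cpow_def_of_ne_zero hZ, ← Complex.log_im, Complex.log_exp, him]
  · rw [him]
    rcases le_or_gt 0 Z.arg with h | h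
    · exact (neg_lt_zero.mpr Real.pi_pos).trans_le (by positivity)
    · have := (abs_le.mp habs).1
      rw [abs_of_neg h, neg_neg] at this
      exact (Complex.neg_pi_lt_arg Z).trans_le this
  · rw [him]
    exact (le_abs_self _).trans (habs.trans (Complex.abs_arg_le_pi Z))

/-- The `m`-th roots in the sector `|arg ζ| < π / (2m)` are the principal ones. -/
lemma pow_cpow_nat_inv_of_abs_arg_lt {m : ℕ} (hm : 1 ≤ m) {ζ : ℂ} (h : |ζ.arg| < Real.pi / m) :
    (ζ ^ m) ^ ((m : ℂ)⁻¹) = ζ :=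
  Complex.pow_cpow_nat_inv (by omega) (abs_lt.mp h).1 (abs_lt.mp h).2.le

/-- The part over the cone `|Im Z| < k Re Z`, `Re Z > R`, in the coordinate `Z = (ω / z)^m`, of the
sector around the ray through `ω`. -/
def petalSector (m : ℕ) (k R : ℝ) (ω : ℂ) : Set ℂ :=
  {z | z ≠ 0 ∧ |(ω / z).arg| < Real.pi / (2 * m) ∧ (ω / z) ^ m ∈ openCone k ∧ R < ((ω / z) ^ m).re}

/-- The region `|w|^M < |z|` over a sector. -/
def petal (m M : ℕ) (k R : ℝ) (ω : ℂ) : Set (Fin 2 → ℂ) :=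
  {y | y 0 ∈ petalSector m k R ω ∧ ‖y 1‖ ^ M < ‖y 0‖}

lemma pi_div_two_mul_lt {m : ℕ} (hm : 1 ≤ m) : Real.pi / (2 * m) < Real.pi / m := by
  have hm1 : (0 : ℝ) < m := by exact_mod_cast hm
  exact div_lt_div_of_pos_left Real.pi_pos hm1 (by linarith)

lemma pi_div_le_pi {m : ℕ} (hm : 1 ≤ m) : Real.pi / m ≤ Real.pi :=
  div_le_self Real.pi_pos.le (by exact_mod_cast hm)

lemma div_pow_eq_fatouCoord {m : ℕ} {a ω : ℂ} (hω : ω ^ m = -(m * a)⁻¹) (z : ℂ) :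
    (ω / z) ^ m = fatouCoord m a z := by
  rw [div_pow, hω, fatouCoord, mul_inv (m * a : ℂ), div_eq_mul_inv, neg_mul]

lemma isOpen_petalSector {m : ℕ} (hm : 1 ≤ m) (k R : ℝ) {ω : ℂ} (hω : ω ≠ 0) :
    IsOpen (petalSector m k R ω) := by
  rw [isOpen_iff_mem_nhds]
  rintro z ⟨hz, harg, hcone, hR⟩
  have hc : ContinuousAt (fun z => ω / z) z := continuousAt_const.div continuousAt_id hz
  have hslit : ω / z ∈ Complex.slitPlane := by
    rw [Complex.mem_slitPlane_iff_arg]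
    refine ⟨fun h => ?_, div_ne_zero hω hz⟩
    rw [h, abs_of_pos Real.pi_pos] at harg
    exact (harg.trans (pi_div_two_mul_lt hm)).not_ge (pi_div_le_pi hm)
  have h1 : ∀ᶠ x in 𝓝 z, x ≠ 0 := isOpen_ne.mem_nhds hz
  have h2 : ∀ᶠ x in 𝓝 z, |(ω / x).arg| < Real.pi / (2 * m) :=
    ContinuousAt.eventually_lt
      (((Complex.continuousAt_arg hslit).comp (f := fun z => ω / z) hc).abs)
      continuousAt_const harg
  have h3 : ∀ᶠ x in 𝓝 z, (ω / x) ^ m ∈ openCone k :=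
    (hc.pow m).eventually ((isOpen_openCone k).mem_nhds hcone)
  have h4 : ∀ᶠ x in 𝓝 z, R < ((ω / x) ^ m).re :=
    continuousAt_const.eventually_lt
      (Complex.continuous_re.continuousAt.comp (hc.pow m)) hR
  filter_upwards [h1, h2, h3, h4] with x h1 h2 h3 h4 using ⟨h1, h2, h3, h4⟩

lemma isOpen_petal {m : ℕ} (hm : 1 ≤ m) (M : ℕ) (k R : ℝ) {ω : ℂ} (hω : ω ≠ 0) :
    IsOpen (petal m M k R ω) := by
  have h1 : IsOpen ((fun y : Fin 2 → ℂ => y 0) ⁻¹' petalSector m k R ω) :=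
    (isOpen_petalSector hm k R hω).preimage (continuous_apply 0)
  have h2 : IsOpen {y : Fin 2 → ℂ | ‖y 1‖ ^ M < ‖y 0‖} := isOpen_lt (by fun_prop) (by fun_prop)
  exact h1.inter h2

/-- The petal is the continuous image of a convex set. -/
lemma petal_eq_image {m M : ℕ} (hm : 1 ≤ m) (hM : 1 ≤ M) {k : ℝ} (hk : 0 < k) (R : ℝ) {ω : ℂ}
    (hω : ω ≠ 0) :
    petal m M k R ω = (fun p : ℂ × ℂ => (![ω / p.1 ^ ((m : ℂ)⁻¹),
      ((‖ω / p.1 ^ ((m : ℂ)⁻¹)‖ ^ ((M : ℝ)⁻¹) : ℝ) : ℂ) * p.2] : Fin 2 → ℂ)) ''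
        ((openCone k ∩ {Z | R < Z.re}) ×ˢ Metric.ball 0 1) := by
  have hM0 : M ≠ 0 := by omega
  ext y
  constructor
  · rintro ⟨⟨hz, harg, hcone, hR⟩, hw⟩
    have hroot := pow_cpow_nat_inv_of_abs_arg_lt hm (harg.trans (pi_div_two_mul_lt hm))
    have hy0 : 0 < ‖y 0‖ := norm_pos_iff.mpr hz
    have hρ : 0 < ‖y 0‖ ^ ((M : ℝ)⁻¹) := by positivity
    have hρM : (‖y 0‖ ^ ((M : ℝ)⁻¹)) ^ M = ‖y 0‖ := Real.rpow_inv_natCast_pow hy0.le hM0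
    -- Dividing w by |z|^{1/M} turns |w|^M < |z| into the unit disc.
    refine ⟨((ω / y 0) ^ m, y 1 / ((‖y 0‖ ^ ((M : ℝ)⁻¹) : ℝ) : ℂ)), ⟨⟨hcone, hR⟩, ?_⟩, ?_⟩
    · rw [mem_ball_zero_iff, norm_div, Complex.norm_real, Real.norm_of_nonneg hρ.le, div_lt_one hρ]
      exact lt_of_pow_lt_pow_left₀ M hρ.le (by rwa [hρM])
    · have e : ω / (ω / y 0) = y 0 := by field_simp
      have hρC : ((‖y 0‖ ^ ((M : ℝ)⁻¹) : ℝ) : ℂ) ≠ 0 := Complex.ofReal_ne_zero.mpr hρ.ne'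
      funext i
      fin_cases i
      · simp only [hroot, e]; rfl
      · simp only [hroot, e]
        exact mul_div_cancel₀ _ hρC
  · rintro ⟨⟨Z, s⟩, ⟨⟨hcone, hR⟩, hs⟩, rfl⟩
    have hre := re_pos_of_mem_openCone hk hcone
    have hZ0 : Z ≠ 0 := fun h => by simp [h] at hre
    have hζ : Z ^ ((m : ℂ)⁻¹) ≠ 0 := by simp [Complex.cpow_eq_zero_iff, hZ0]
    have hζm : (Z ^ ((m : ℂ)⁻¹)) ^ m = Z := Complex.cpow_nat_inv_pow Z (by omega)
    have e : ω / (ω / Z ^ ((m : ℂ)⁻¹)) = Z ^ ((m : ℂ)⁻¹) := by field_simp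
    have hz : ω / Z ^ ((m : ℂ)⁻¹) ≠ 0 := div_ne_zero hω hζ
    refine ⟨⟨hz, ?_, ?_, ?_⟩, ?_⟩
    · simp only [Matrix.cons_val_zero, e]
      rw [arg_cpow_nat_inv hm hZ0, abs_div, Nat.abs_cast, ← div_div]
      have hm0 : (0 : ℝ) < m := by exact_mod_cast hm
      exact div_lt_div_of_pos_right (Complex.abs_arg_lt_pi_div_two_iff.mpr (Or.inl hre)) hm0
    · simpa only [Matrix.cons_val_zero, e, hζm] using hcone
    · simp only [Matrix.cons_val_zero, e, hζm]
      exact hR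
    · have hz0 : 0 < ‖ω / Z ^ ((m : ℂ)⁻¹)‖ := norm_pos_iff.mpr hz
      simp only [Matrix.cons_val_zero, Matrix.cons_val_one, Matrix.cons_val_fin_one]
      rw [norm_mul, Complex.norm_real, Real.norm_of_nonneg (by positivity), mul_pow,
        Real.rpow_inv_natCast_pow hz0.le hM0]
      rw [mem_ball_zero_iff] at hs
      exact mul_lt_of_lt_one_right hz0 (pow_lt_one₀ (norm_nonneg _) hs hM0)

lemma isPreconnected_petal {m M : ℕ} (hm : 1 ≤ m) (hM : 1 ≤ M) {k : ℝ} (hk : 0 < k) (R : ℝ) {ω : ℂ}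
    (hω : ω ≠ 0) : IsPreconnected (petal m M k R ω) := by
  rw [petal_eq_image hm hM hk R hω]
  refine IsPreconnected.image ?_ _ ?_
  · exact ((convex_openCone k).inter (convex_halfSpace_re_gt R)).isPreconnected.prod
      (convex_ball 0 1).isPreconnected
  · rintro ⟨Z, s⟩ ⟨⟨hcone, -⟩, -⟩
    have hre := re_pos_of_mem_openCone hk hcone
    have hZ0 : Z ≠ 0 := fun h => by simp [h] at hre
    have hc : ContinuousAt (fun p : ℂ × ℂ => ω / p.1 ^ ((m : ℂ)⁻¹)) (Z, s) := by
      refine continuousAt_const.div (continuousAt_fst.cpow continuousAt_const (Or.inl hre)) ?_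
      simp [Complex.cpow_eq_zero_iff, hZ0]
    refine ContinuousAt.continuousWithinAt (continuousAt_pi.mpr fun i => ?_)
    fin_cases i
    · exact hc
    · refine ContinuousAt.mul ?_ continuousAt_snd
      exact Complex.continuous_ofReal.continuousAt.comp
        (hc.norm.rpow_const (Or.inr (by positivity)))

/-- At a common point, ω/z and ω'/z would both be the principal m-th root of the same number. -/
lemma disjoint_petal {m M : ℕ} (hm : 1 ≤ m) (k R : ℝ) {ω ω' : ℂ} (h : ω ^ m = ω' ^ m)
    (hne : ω ≠ ω') : Disjoint (petal m M k R ω) (petal m M k R ω') := by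
  rw [Set.disjoint_left]
  rintro y ⟨⟨hz, harg, -, -⟩, -⟩ ⟨⟨-, harg', -, -⟩, -⟩
  have h1 := pow_cpow_nat_inv_of_abs_arg_lt hm (harg.trans (pi_div_two_mul_lt hm))
  have h2 := pow_cpow_nat_inv_of_abs_arg_lt hm (harg'.trans (pi_div_two_mul_lt hm))
  rw [div_pow, h, ← div_pow, h2] at h1
  exact hne (by field_simp at h1; exact h1.symm)

/-- The ray through ω in w = 0 lies eventually in the petal (`eventually_petal_axis`), which puts 0
in its closure. -/
lemma tendsto_petal_axis (ω : ℂ) :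
    Tendsto (fun t : ℝ => (![ω / (t : ℂ), 0] : Fin 2 → ℂ)) atTop (𝓝 0) := by
  rw [tendsto_pi_nhds]
  intro i
  fin_cases i
  · have h : Tendsto (fun t : ℝ => ω * ((t⁻¹ : ℝ) : ℂ)) atTop (𝓝 (ω * ((0 : ℝ) : ℂ))) :=
      ((Complex.continuous_ofReal.tendsto 0).comp tendsto_inv_atTop_zero).const_mul ω
    simpa [div_eq_mul_inv] using h
  · exact tendsto_const_nhds

lemma eventually_petal_axis {m M : ℕ} (hm : 1 ≤ m) (hM : 1 ≤ M) {k : ℝ} (hk : 0 < k) (R : ℝ) {ω : ℂ}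
    (hω : ω ≠ 0) : ∀ᶠ t : ℝ in atTop, (![ω / (t : ℂ), 0] : Fin 2 → ℂ) ∈ petal m M k R ω := by
  filter_upwards [eventually_gt_atTop (max 1 R)] with t ht
  have ht1 : 1 < t := (le_max_left _ _).trans_lt ht
  have htR : R < t ^ m := ((le_max_right _ _).trans_lt ht).trans_le
    (le_self_pow₀ ht1.le (by omega))
  have ht0 : 0 < t := by linarith
  have htC : (t : ℂ) ≠ 0 := Complex.ofReal_ne_zero.mpr ht0.ne'
  have e : ω / (ω / (t : ℂ)) = t := by field_simp
  have hm0 : (0 : ℝ) < m := by exact_mod_cast hm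
  refine ⟨⟨div_ne_zero hω htC, ?_, ?_, ?_⟩, ?_⟩
  · simp only [Matrix.cons_val_zero, e, Complex.arg_ofReal_of_nonneg ht0.le, abs_zero]
    have := Real.pi_pos
    positivity
  · simp only [Matrix.cons_val_zero, e, ← Complex.ofReal_pow]
    change |((t ^ m : ℝ) : ℂ).im| < k * ((t ^ m : ℝ) : ℂ).re
    rw [Complex.ofReal_im, Complex.ofReal_re, abs_zero]
    positivity
  · simpa only [Matrix.cons_val_zero, e, ← Complex.ofReal_pow, Complex.ofReal_re] using htR
  · simp [show M ≠ 0 by omega, hω, ht0.ne']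

lemma norm_lt_of_lt_norm_fatouCoord {m : ℕ} (hm : 1 ≤ m) {a : ℂ} (ha : a ≠ 0) {r : ℝ} (hr : 0 < r)
    {z : ℂ} (h : (m * ‖a‖ * r ^ m)⁻¹ < ‖fatouCoord m a z‖) : ‖z‖ < r := by
  have ha0 : 0 < ‖a‖ := norm_pos_iff.mpr ha
  have hm0 : (0 : ℝ) < m := by exact_mod_cast hm
  rw [norm_fatouCoord] at h
  by_contra hcon
  refine h.not_ge (inv_anti₀ (by positivity) ?_)
  gcongr
  exact not_lt.mp hcon

lemma norm_lt_of_norm_fatouCoord_lt {m : ℕ} (hm : 1 ≤ m) {a : ℂ} (ha : a ≠ 0)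
    {z z' : ℂ} (hz : z ≠ 0) (h : ‖fatouCoord m a z‖ < ‖fatouCoord m a z'‖) : ‖z'‖ < ‖z‖ :=
  norm_lt_of_lt_norm_fatouCoord hm ha (norm_pos_iff.mpr hz) (by rwa [← norm_fatouCoord])

/-- Invariance of the petal under one step that moves the Fatou coordinate approximately by `1`. -/
lemma petal_step {m M : ℕ} (hm : 1 ≤ m) {a ω : ℂ} (ha : a ≠ 0) (hω : ω ^ m = -(m * a)⁻¹)
    (hω0 : ω ≠ 0) {k R : ℝ} (hk : 0 < k) (hk1 : k ≤ 1) {y y' : Fin 2 → ℂ} (hy : y ∈ petal m M k R ω)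
    (hz' : y' 0 ≠ 0)
    (hstep : ‖fatouCoord m a (y' 0) - (fatouCoord m a (y 0) + 1)‖ ≤ k / 4)
    (harg : |(y 0 / y' 0).arg| < Real.pi / (2 * m)) (hw' : ‖y' 1‖ ^ M < ‖y' 0‖) :
    y' ∈ petal m M k R ω ∧ ‖y' 0‖ < ‖y 0‖ ∧
      (fatouCoord m a (y 0)).re + 1 / 2 ≤ (fatouCoord m a (y' 0)).re := by
  obtain ⟨⟨hz, hyarg, hcone, hR⟩, -⟩ := hy
  rw [div_pow_eq_fatouCoord hω] at hcone hR
  obtain ⟨h1, h2, h3⟩ := openCone_step hk hk1 hcone hstep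
  refine ⟨⟨⟨hz', ?_, ?_, ?_⟩, hw'⟩, norm_lt_of_norm_fatouCoord_lt hm ha hz h2, h3⟩
  · have e : ω / y' 0 = ω / y 0 * (y 0 / y' 0) := by field_simp
    have hm0 : (0 : ℝ) < m := by exact_mod_cast hm
    -- The sum of two angles below π/(2m) is below π/m, just enough to identify ω/z' as the
    -- principal root of the new Fatou coordinate. That coordinate lies in the right half plane,
    -- which restores the bound π/(2m).
    have hsum : |(ω / y 0).arg + (y 0 / y' 0).arg| < Real.pi / m := by
      refine (abs_add_le _ _).trans_lt ((add_lt_add hyarg harg).trans_eq ?_)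
      field_simp
      norm_num
    have harg' : (ω / y' 0).arg = (ω / y 0).arg + (y 0 / y' 0).arg := by
      rw [e]
      refine Complex.arg_mul (div_ne_zero hω0 hz) (div_ne_zero hz hz') ?_
      have := abs_lt.mp (hsum.trans_le (pi_div_le_pi hm))
      exact ⟨this.1, this.2.le⟩
    have hroot := pow_cpow_nat_inv_of_abs_arg_lt hm (harg'.symm ▸ hsum)
    have hre := re_pos_of_mem_openCone hk h1
    have hZ0 : fatouCoord m a (y' 0) ≠ 0 := fun h => by simp [h] at hre
    rw [← hroot, div_pow_eq_fatouCoord hω, arg_cpow_nat_inv hm hZ0, abs_div,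
      Nat.abs_cast, ← div_div]
    exact div_lt_div_of_pos_right (Complex.abs_arg_lt_pi_div_two_iff.mpr (Or.inl hre)) hm0
  · rwa [div_pow_eq_fatouCoord hω]
  · rw [div_pow_eq_fatouCoord hω]; linarith

/-- This turns the coordinate error ‖y‖^{M(m+3)} into one bounded by |z|^{m+3}. -/
lemma norm_pow_le_of_petal {M : ℕ} (hM : 1 ≤ M) {y : Fin 2 → ℂ} (h0 : ‖y 0‖ ≤ 1)
    (h1 : ‖y 1‖ ^ M < ‖y 0‖) : ‖y‖ ^ M ≤ ‖y 0‖ := by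
  have h : ‖y‖ ≤ max ‖y 0‖ ‖y 1‖ := by
    rw [pi_norm_le_iff_of_nonneg (le_max_of_le_left (norm_nonneg _))]
    intro i
    fin_cases i
    · exact le_max_left _ _
    · exact le_max_right _ _
  refine (pow_le_pow_left₀ (norm_nonneg _) h M).trans ?_
  rcases max_cases ‖y 0‖ ‖y 1‖ with ⟨h, -⟩ | ⟨h, -⟩ <;> rw [h]
  · exact pow_le_of_le_one (norm_nonneg _) h0 (by omega)
  · exact h1.le

/-! ### Neighbourhood basis and basins of attraction -/

/-- The polydiscs `|z| < r`, `|w|^M < r`. -/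
def weightedPolydisc (M : ℕ) (r : ℝ) : Set (Fin 2 → ℂ) := {y | ‖y 0‖ < r ∧ ‖y 1‖ ^ M < r}

lemma weightedPolydisc_mem_nhds {M : ℕ} (hM : 1 ≤ M) {r : ℝ} (hr : 0 < r) :
    weightedPolydisc M r ∈ 𝓝 0 := by
  have h1 : IsOpen {y : Fin 2 → ℂ | ‖y 0‖ < r} := isOpen_lt (by fun_prop) (by fun_prop)
  have h2 : IsOpen {y : Fin 2 → ℂ | ‖y 1‖ ^ M < r} := isOpen_lt (by fun_prop) (by fun_prop)
  exact (h1.inter h2).mem_nhds ⟨by simpa using hr, by simpa [show M ≠ 0 by omega] using hr⟩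

lemma exists_weightedPolydisc_subset (M : ℕ) {s : Set (Fin 2 → ℂ)} (hs : s ∈ 𝓝 0) :
    ∃ r : ℝ, 0 < r ∧ weightedPolydisc M r ⊆ s := by
  obtain ⟨ε, hε, hball⟩ := Metric.mem_nhds_iff.mp hs
  refine ⟨min ε (ε ^ M), by positivity, fun y hy => hball ?_⟩
  rw [mem_ball_zero_iff, pi_norm_lt_iff hε]
  intro i
  fin_cases i
  · exact hy.1.trans_le (min_le_left _ _)
  · exact lt_of_pow_lt_pow_left₀ M hε.le (hy.2.trans_le (min_le_right _ _))

lemma hasBasis_preimage_weightedPolydisc {M : ℕ} (hM : 1 ≤ M)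
    {φ : OpenPartialHomeomorph (Fin 2 → ℂ) (Fin 2 → ℂ)} (h0 : 0 ∈ φ.source) (hφ0 : φ 0 = 0) :
    (𝓝 (0 : Fin 2 → ℂ)).HasBasis
      (fun Ω => Ω ∈ {Ω | ∃ r : ℝ, 0 < r ∧ Ω = φ.source ∩ φ ⁻¹' weightedPolydisc M r}) id := by
  refine ⟨fun t => ⟨fun ht => ?_, ?_⟩⟩
  · have h0t : (0 : Fin 2 → ℂ) ∈ φ.target := hφ0 ▸ φ.map_source h0
    have hs0 : φ.symm 0 = 0 := by simpa [hφ0] using φ.left_inv h0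
    have hpre : φ.symm ⁻¹' t ∈ 𝓝 0 := (φ.symm.continuousAt h0t).preimage_mem_nhds (by rwa [hs0])
    obtain ⟨r, hr, hsub⟩ := exists_weightedPolydisc_subset M hpre
    refine ⟨_, ⟨r, hr, rfl⟩, fun x hx => ?_⟩
    have := hsub hx.2
    rwa [Set.mem_preimage, φ.left_inv hx.1] at this
  · rintro ⟨_, ⟨r, hr, rfl⟩, hsub⟩
    refine mem_of_superset (inter_mem (φ.open_source.mem_nhds h0) ?_) hsub
    exact (φ.continuousAt h0).preimage_mem_nhds (by rw [hφ0]; exact weightedPolydisc_mem_nhds hM hr)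

/-- A petal that is invariant in local coordinates, with Fatou coordinates growing linearly along
orbits, is a connected basin of attraction. -/
lemma isBasinOfAttraction_petal {D : Set (Fin 2 → ℂ)} {F : (Fin 2 → ℂ) → Fin 2 → ℂ} {m M : ℕ}
    (hm : 1 ≤ m) (hM : 1 ≤ M) {a ω : ℂ} (ha : a ≠ 0) (hω0 : ω ≠ 0) {k R : ℝ} (hk : 0 < k)
    {φ : OpenPartialHomeomorph (Fin 2 → ℂ) (Fin 2 → ℂ)}
    (h0 : 0 ∈ φ.source) (hφ0 : φ 0 = 0) (htarget : petal m M k R ω ⊆ φ.target)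
    (hD : ∀ x ∈ φ.source, φ x ∈ petal m M k R ω → x ∈ D)
    (hstep : ∀ x ∈ φ.source, φ x ∈ petal m M k R ω → F x ∈ φ.source ∧
      φ (F x) ∈ petal m M k R ω ∧ ‖φ (F x) 0‖ < ‖φ x 0‖ ∧
      (fatouCoord m a (φ x 0)).re + 1 / 2 ≤ (fatouCoord m a (φ (F x) 0)).re) :
    IsConnected (φ.source ∩ φ ⁻¹' petal m M k R ω) ∧
      IsBasinOfAttraction D F (φ.source ∩ φ ⁻¹' petal m M k R ω) := by
  set U := φ.source ∩ φ ⁻¹' petal m M k R ω with hU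
  have h0t : (0 : Fin 2 → ℂ) ∈ φ.target := hφ0 ▸ φ.map_source h0
  have hs0 : φ.symm 0 = 0 := by simpa [hφ0] using φ.left_inv h0
  have himage : φ.symm '' petal m M k R ω = U :=
    φ.toPartialEquiv.symm_image_eq_source_inter_preimage htarget
  have hclosure : (0 : Fin 2 → ℂ) ∈ closure U := by
    have ht := (φ.symm.continuousAt h0t).tendsto.comp (tendsto_petal_axis ω)
    rw [hs0] at ht
    refine mem_closure_of_tendsto ht ?_
    filter_upwards [eventually_petal_axis hm hM hk R hω0] with t ht
    rw [← himage]
    exact Set.mem_image_of_mem _ ht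
  have hne : U.Nonempty := closure_nonempty_iff.mp ⟨0, hclosure⟩
  have hconn : IsConnected U := by
    refine ⟨hne, ?_⟩
    rw [← himage]
    exact (isPreconnected_petal hm hM hk R hω0).image _ (φ.symm.continuousOn.mono htarget)
  have hmaps : ∀ x ∈ U, F x ∈ U := fun x hx =>
    ⟨(hstep x hx.1 hx.2).1, (hstep x hx.1 hx.2).2.1⟩
  refine ⟨hconn, hne, φ.isOpen_inter_preimage (isOpen_petal hm M k R hω0),
    fun x hx => hD x hx.1 hx.2, hclosure, _, hasBasis_preimage_weightedPolydisc hM h0 hφ0, ?_⟩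
  rintro _ ⟨r, hr, rfl⟩
  refine ⟨fun x hx => ⟨hmaps x hx.1, (hmaps x hx.1).1, ?_⟩, fun x hx => ?_⟩
  -- Inside the petal, membership in a weighted polydisc reduces to |z| < r, and |z| decreases along
  -- orbits.
  · have hlt : ‖φ (F x) 0‖ < r := (hstep x hx.1.1 hx.1.2).2.2.1.trans hx.2.2.1
    exact ⟨hlt, (hmaps x hx.1).2.2.trans hlt⟩
  · have hiter : ∀ n : ℕ, F^[n] x ∈ U ∧
        (fatouCoord m a (φ x 0)).re + n / 2 ≤ (fatouCoord m a (φ (F^[n] x) 0)).re := by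
      intro n
      induction n with
      | zero => exact ⟨hx.1, by simp⟩
      | succ n ih =>
        rw [Function.iterate_succ_apply']
        refine ⟨hmaps _ ih.1, ?_⟩
        have := (hstep _ ih.1.1 ih.1.2).2.2.2
        push_cast
        linarith [ih.2]
    rw [(hasBasis_preimage_weightedPolydisc hM h0 hφ0).tendsto_right_iff]
    rintro _ ⟨ε, hε, rfl⟩
    -- Re Z → ∞ forces z → 0, and |w|^M < |z| carries w along.
    have hgrow : Tendsto (fun n : ℕ => (fatouCoord m a (φ x 0)).re + (n : ℝ) / 2) atTop atTop :=
      tendsto_atTop_add_const_left _ _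
        (tendsto_natCast_atTop_atTop.atTop_div_const two_pos)
    filter_upwards [hgrow.eventually_gt_atTop (m * ‖a‖ * ε ^ m)⁻¹] with n hn
    have hlt : ‖φ (F^[n] x) 0‖ < ε := norm_lt_of_lt_norm_fatouCoord hm ha hε
      ((hn.trans_le (hiter n).2).trans_le (Complex.re_le_norm _))
    exact ⟨(hiter n).1.1, hlt, (hiter n).1.2.2.trans hlt⟩

/-! ### The m petals and the conclusion -/

/-- There are `m` distinct `m`-th roots of a nonzero complex number. -/
lemma exists_injective_pow_eq {m : ℕ} (hm : 1 ≤ m) {c : ℂ} (hc : c ≠ 0) :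
    ∃ ω : Fin m → ℂ, Function.Injective ω ∧ ∀ i, ω i ^ m = c := by
  obtain ⟨ω₀, hω₀⟩ := IsAlgClosed.exists_pow_nat_eq c (by omega : 0 < m)
  have hne : ω₀ ≠ 0 := by
    rintro rfl
    rw [zero_pow (by omega)] at hω₀
    exact hc hω₀.symm
  have hprim := Complex.isPrimitiveRoot_exp m (by omega)
  refine ⟨fun i => ω₀ * Complex.exp (2 * Real.pi * Complex.I / m) ^ (i : ℕ), fun i j hij => ?_,
    fun i => ?_⟩
  · exact Fin.ext (hprim.pow_inj i.2 j.2 (mul_left_cancel₀ hne hij))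
  · rw [mul_pow, hω₀, ← pow_mul, mul_comm (i : ℕ), pow_mul, hprim.pow_eq_one, one_pow, mul_one]

lemma norm_unitEigenvalue (θ : ℝ) : ‖unitEigenvalue θ‖ = 1 := by
  have : unitEigenvalue θ = Complex.exp ((2 * Real.pi * θ : ℝ) * Complex.I) := by
    rw [unitEigenvalue]; push_cast; ring_nf
  rw [this, Complex.norm_exp_ofReal_mul_I]

/-- Existence of the petals, in terms of the leading terms of the normal form. -/
theorem exists_basins_of_leading_terms {θ : ℝ} {D : Set (Fin 2 → ℂ)}
    {F : (Fin 2 → ℂ) → Fin 2 → ℂ} (hF : IsQuasiParabolic θ D F) {a b : ℕ → ℂ}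
    (hconj : IsFormallyConjugate F (quasiParabolicNormalForm θ a b)) {m : ℕ} (hm : 1 ≤ m)
    (ha : ∀ j, 2 ≤ j → j < m + 1 → a j = 0) (hb : ∀ j, 1 ≤ j → j < m → b j = 0)
    (ha0 : a (m + 1) ≠ 0) (hre : 0 < (b m / (unitEigenvalue θ * a (m + 1))).re) :
    ∃ U : Fin m → Set (Fin 2 → ℂ),
      (∀ i, IsConnected (U i) ∧ IsBasinOfAttraction D F (U i)) ∧
        Pairwise (Function.onFun Disjoint U) := by
  have hmC : (m : ℂ) ≠ 0 := by exact_mod_cast (by omega : m ≠ 0)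
  have hm0 : (0 : ℝ) < m := by exact_mod_cast hm
  obtain ⟨k, M, hk, hk1, hM, hstep⟩ := exists_petal_step hm ha0 (norm_unitEigenvalue θ) hre
    (div_pos Real.pi_pos (mul_pos two_pos hm0))
  have hN : m + 2 ≤ M * (m + 3) := by nlinarith
  obtain ⟨φ, h0, hφ0, C, hC, hest⟩ := hconj.exists_coordinates hF.map_zero hm hN ha hb
  have h0t : (0 : Fin 2 → ℂ) ∈ φ.target := hφ0 ▸ φ.map_source h0
  have hs0 : φ.symm 0 = 0 := by simpa [hφ0] using φ.left_inv h0
  have hFsrc : ∀ᶠ x in 𝓝 (0 : Fin 2 → ℂ), F x ∈ φ.source := by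
    have hc : ContinuousAt F 0 :=
      (hF.differentiableOn.differentiableAt (hF.isOpen.mem_nhds hF.zero_mem)).continuousAt
    exact hc.eventually (by rw [hF.map_zero]; exact φ.open_source.mem_nhds h0)
  have hgood : ∀ᶠ y in 𝓝 (0 : Fin 2 → ℂ), y ∈ φ.target ∧ φ.symm y ∈ D ∧ F (φ.symm y) ∈ φ.source ∧
      (‖φ (F (φ.symm y)) 0 - (φ (φ.symm y) 0 + a (m + 1) * φ (φ.symm y) 0 ^ (m + 1))‖ ≤
        C * (‖φ (φ.symm y) 0‖ ^ (m + 2) + ‖φ (φ.symm y)‖ ^ (M * (m + 3))) ∧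
      ‖φ (F (φ.symm y)) 1 - (unitEigenvalue θ * φ (φ.symm y) 1 +
          b m * φ (φ.symm y) 0 ^ m * φ (φ.symm y) 1)‖ ≤
        C * (‖φ (φ.symm y) 0‖ ^ (m + 1) * ‖φ (φ.symm y) 1‖ +
          ‖φ (φ.symm y)‖ ^ (M * (m + 3)))) := by
    have hc := (φ.symm.continuousAt h0t).tendsto
    rw [hs0] at hc
    have ht : ∀ᶠ y in 𝓝 (0 : Fin 2 → ℂ), y ∈ φ.target := φ.open_target.mem_nhds h0t
    have hd : ∀ᶠ x in 𝓝 (0 : Fin 2 → ℂ), x ∈ D := hF.isOpen.mem_nhds hF.zero_mem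
    exact ht.and (hc.eventually (hd.and (hFsrc.and hest)))
  obtain ⟨r, hr, hrsub⟩ := exists_weightedPolydisc_subset M hgood
  obtain ⟨δ, hδ, hδstep⟩ := Metric.eventually_nhds_iff_ball.mp (hstep C hC)
  obtain ⟨ω, hωinj, hω⟩ := exists_injective_pow_eq hm (c := -(m * a (m + 1))⁻¹)
    (neg_ne_zero.mpr (inv_ne_zero (mul_ne_zero hmC ha0)))
  have hω0 : ∀ i, ω i ≠ 0 := by
    intro i h
    have := hω i
    rw [h, zero_pow (by omega)] at this
    exact neg_ne_zero.mpr (inv_ne_zero (mul_ne_zero hmC ha0)) this.symm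
  -- Re Z > R forces |z| < t. The bound 1 serves ‖y‖^M ≤ |z|, r the coordinate estimates, and δ the
  -- one-step lemma.
  set t : ℝ := min 1 (min r δ)
  have ht : 0 < t := by positivity
  set R : ℝ := (m * ‖a (m + 1)‖ * t ^ m)⁻¹
  have hsmall : ∀ i, ∀ y ∈ petal m M k R (ω i), ‖y 0‖ < t := by
    rintro i y ⟨⟨-, -, -, hR⟩, -⟩
    rw [div_pow_eq_fatouCoord (hω i)] at hR
    exact norm_lt_of_lt_norm_fatouCoord hm ha0 ht (hR.trans_le (Complex.re_le_norm _))
  have hpoly : ∀ i, ∀ y ∈ petal m M k R (ω i), y ∈ weightedPolydisc M r := by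
    intro i y hy
    have hlt : ‖y 0‖ < r := (hsmall i y hy).trans_le ((min_le_right _ _).trans (min_le_left _ _))
    exact ⟨hlt, hy.2.trans hlt⟩
  refine ⟨fun i => φ.source ∩ φ ⁻¹' petal m M k R (ω i), fun i => ?_, fun i j hij => ?_⟩
  · refine isBasinOfAttraction_petal hm hM ha0 (hω0 i) hk h0 hφ0
      (fun y hy => (hrsub (hpoly i y hy)).1)
      (fun x hx hpx => ?_) (fun x hx hpx => ?_)
    · have := (hrsub (hpoly i _ hpx)).2.1
      rwa [φ.left_inv hx] at this
    · obtain ⟨-, -, hsrc, he0, he1⟩ := hrsub (hpoly i _ hpx)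
      rw [φ.left_inv hx] at hsrc he0 he1
      have hz1 := hsmall i _ hpx
      have hcone : fatouCoord m (a (m + 1)) (φ x 0) ∈ openCone k := by
        rw [← div_pow_eq_fatouCoord (hω i)]; exact hpx.1.2.2.1
      obtain ⟨q1, q2, q3, q4⟩ := hδstep (φ x 0)
        (by
          rw [mem_ball_zero_iff]
          exact hz1.trans_le ((min_le_right _ _).trans (min_le_right _ _)))
        hpx.1.1 hcone (φ x 1) (φ (F x) 0) (φ (F x) 1) ‖φ x‖ hpx.2 (norm_nonneg _)
        (norm_pow_le_of_petal hM (hz1.le.trans (min_le_left _ _)) hpx.2) he0 he1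
      exact ⟨hsrc, petal_step hm ha0 (hω i) (hω0 i) hk hk1 hpx q1 q2 q3 q4⟩
  · exact ((disjoint_petal hm k R ((hω i).trans (hω j).symm) (hωinj.ne hij)).preimage φ).mono
      Set.inter_subset_right Set.inter_subset_right

end

theorem corollary6p3 (θ : ℝ) (hθ : Irrational θ)
    (D : Set (Fin 2 → ℂ)) (F : (Fin 2 → ℂ) → (Fin 2 → ℂ))
    (hF : IsQuasiParabolic θ D F) (hsep : IsDynamicallySeparating θ F)
    (a b : ℕ → ℂ) (hconj : IsFormallyConjugate F (quasiParabolicNormalForm θ a b))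
    (ν : ℕ) (hν : normalFormNu a = ν)
    (hre : 0 < (b (ν - 1) / (unitEigenvalue θ * a ν)).re) :
    ∃ U : Fin (ν - 1) → Set (Fin 2 → ℂ),
      (∀ i, IsConnected (U i) ∧ IsBasinOfAttraction D F (U i)) ∧
        Pairwise (Function.onFun Disjoint U) := by
  have h2 : 2 ≤ ν := by
    have : (2 : ℕ∞) ≤ normalFormNu a := le_iInf₂ fun j hj => by exact_mod_cast hj.1
    rw [hν] at this
    exact_mod_cast this
  have ha : ∀ j, 2 ≤ j → j < ν → a j = 0 := by
    intro j hj hjν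
    by_contra hne
    have : normalFormNu a ≤ j := iInf₂_le j ⟨hj, hne⟩
    rw [hν] at this
    exact hjν.not_ge (by exact_mod_cast this)
  -- This is the separating condition ν ≤ μ + 1.
  have hb : ∀ j, 1 ≤ j → j < ν - 1 → b j = 0 := by
    intro j hj hjν
    by_contra hne
    have h1 := (hsep.2 a b hconj).2
    have h3 : normalFormMu b ≤ j := iInf₂_le j ⟨hj, hne⟩
    have h4 : (ν : ℕ∞) ≤ (j + 1 : ℕ) := by
      rw [hν] at h1
      push_cast
      exact h1.trans (add_le_add_left h3 1)
    have h5 : ν ≤ j + 1 := by exact_mod_cast h4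
    omega
  -- If a_ν were 0, the quotient in `hre` would be a division by zero, with value 0.
  have ha0 : a ν ≠ 0 := by
    intro h
    simp [h] at hre
  obtain ⟨m, rfl⟩ : ∃ m, ν = m + 1 := ⟨ν - 1, by omega⟩
  exact exists_basins_of_leading_terms hF hconj (by omega) ha hb ha0 hre
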